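/- Let $[a,b]\subset\mathbb R$ be a compact interval with $a<b$, let $m,r\ge 1$ and $n\ge 0$ be integers and $1\le p\le\infty$. Let $W_p^n$ be the complex Sobolev space on $(a,b)$ with norm $\|u\|_{n,p}=\sum_{k=0}^{n}\|u^{(k)}\|_{L_p}$ ($W_p^0=L_p$); the norm of a vector- or matrix-valued function is the sum of the norms of its entries and is denoted in the same way. Fix $\varepsilon_0>0$. For every $\varepsilon\in[0,\varepsilon_0)$ let matrix-valued functions $A_0(\cdot;\varepsilon),\dots,A_{r-1}(\cdot;\varepsilon)\in(W_p^n)^{m\times m}$ and a continuous linear operator $B(\varepsilon)\colon(W_p^{n+r})^m\to\mathbb C^{rm}$ be given, and put $$L(\varepsilon)y:=y^{(r)}+\sum_{j=1}^{r}A_{r-j}(\cdot;\varepsilon)\,y^{(r-j)}\in (W_p^n)^m,\qquad y\in(W_p^{n+r})^m .$$ For right-hand sides $f(\cdot;\varepsilon)\in(W_p^n)^m$ and $c(\varepsilon)\in\mathbb C^{rm}$ consider the boundary-value problem $$L(\varepsilon)y(\cdot;\varepsilon)=f(\cdot;\varepsilon),\qquad B(\varepsilon)y(\cdot;\varepsilon)=c(\varepsilon)\tag{$*$}$$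 with the unknown $y(\cdot;\varepsilon)\in(W_p^{n+r})^m$. **Theorem 2.** Assume: * Condition (0): the homogeneous problem $L(0)y=0$, $B(0)y=0$ has only the trivial solution in $(W_p^{n+r})^m$; * Limit Condition (I): $A_{r-j}(\cdot;\varepsilon)\to A_{r-j}(\cdot;0)$ in $(W_p^n)^{m\times m}$ as $\varepsilon\to0+$ for each $j\in\{1,\dots,r\}$; * Limit Condition (II): $B(\varepsilon)y\to B(0)y$ in $\mathbb C^{rm}$ as $\varepsilon\to0+$ for every $y\in(W_p^{n+r})^m$. Then there is $\varepsilon_1\in(0,\varepsilon_0)$ such that for every $\varepsilon\in[0,\varepsilon_1)$ problem $(*)$ has exactly one solution for every right-hand side in $(W_p^n)^m\times\mathbb C^{rm}$, and there are $\varepsilon_2\in(0,\varepsilon_1)$ and $\gamma_1,\gamma_2>0$, depending neither on the right-hand sides $f(\cdot;\varepsilon)$, $c(\varepsilon)$ nor on the solutions $y(\cdot;\varepsilon)$, such that for all $\varepsilon\in(0,\varepsilon_2)$ $$\gamma_1\,\tilde d_{n,p}(\varepsilon)\le\|y(\cdot;0)-y(\cdot;\varepsilon)\|_{n+r,p}\le\gamma_2\,\tilde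 d_{n,p}(\varepsilon),$$ where $y(\cdot;\varepsilon)$ denotes the solution of $(*)$ and $$\tilde d_{n,p}(\varepsilon)=\|L(\varepsilon)y(\cdot;0)-f(\cdot;\varepsilon)\|_{n,p}+\|B(\varepsilon)y(\cdot;0)-c(\varepsilon)\|_{\mathbb C^{rm}}.$$ -/

import Mathlib

open MeasureTheory Set Filter
open scoped ENNReal Topology ContDiff

namespace GenericBVP

/-- `g` is the weak (distributional) derivative of `f` on the interval `(a, b)`. -/
def HasWeakDeriv (a b : ℝ) (f g : ℝ → ℂ) : Prop :=
  ∀ φ : ℝ → ℝ, ContDiff ℝ ∞ φ → HasCompactSupport φ → tsupport φ ⊆ Ioo a b →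
    ∫ x in Ioo a b, deriv φ x • f x = - ∫ x in Ioo a b, φ x • g x

section WeakDerivative

variable {a b : ℝ} {f g f' g' : ℝ → ℂ}

theorem HasWeakDeriv.congr (h : HasWeakDeriv a b f g)
    (hf : f =ᵐ[volume.restrict (Ioo a b)] f') (hg : g =ᵐ[volume.restrict (Ioo a b)] g') :
    HasWeakDeriv a b f' g' := by
  intro φ h1 h2 h3
  have e1 : ∫ x in Ioo a b, deriv φ x • f' x = ∫ x in Ioo a b, deriv φ x • f x :=
    integral_congr_ae (by filter_upwards [hf] with x hx; rw [hx])
  have e2 : ∫ x in Ioo a b, φ x • g' x = ∫ x in Ioo a b, φ x • g x :=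
    integral_congr_ae (by filter_upwards [hg] with x hx; rw [hx])
  rw [e1, e2]
  exact h φ h1 h2 h3

theorem integrable_smul_of_test {φ : ℝ → ℝ} (h1 : Continuous φ) (h2 : HasCompactSupport φ)
    (hf : IntegrableOn f (Ioo a b)) : IntegrableOn (fun x => φ x • f x) (Ioo a b) := by
  obtain ⟨C, hC⟩ := h1.bounded_above_of_compact_support h2
  exact hf.bdd_smul C h1.aestronglyMeasurable (Eventually.of_forall hC)

theorem HasWeakDeriv.add (hf : IntegrableOn f (Ioo a b)) (hg : IntegrableOn g (Ioo a b))
    (hf' : IntegrableOn f' (Ioo a b)) (hg' : IntegrableOn g' (Ioo a b))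
    (h : HasWeakDeriv a b f g) (h' : HasWeakDeriv a b f' g') :
    HasWeakDeriv a b (fun x => f x + f' x) (fun x => g x + g' x) := by
  intro φ h1 h2 h3
  have c1 : Continuous φ := h1.continuous
  have c2 : Continuous (deriv φ) := h1.continuous_deriv (by simp)
  simp only [smul_add]
  rw [integral_add (integrable_smul_of_test c2 h2.deriv hf)
      (integrable_smul_of_test c2 h2.deriv hf'),
    integral_add (integrable_smul_of_test c1 h2 hg) (integrable_smul_of_test c1 h2 hg'),
    h φ h1 h2 h3, h' φ h1 h2 h3, neg_add]

theorem HasWeakDeriv.const_mul (c : ℂ) (h : HasWeakDeriv a b f g) :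
    HasWeakDeriv a b (fun x => c * f x) (fun x => c * g x) := by
  intro φ h1 h2 h3
  have e (ψ : ℝ → ℝ) (u : ℝ → ℂ) : ∫ x in Ioo a b, ψ x • (c * u x) =
      c * ∫ x in Ioo a b, ψ x • u x := by
    rw [← integral_const_mul]
    congr 1
    ext x
    simp only [Complex.real_smul]
    ring
  rw [e, e, h φ h1 h2 h3, mul_neg]

/-- The weak derivative is unique up to a null set. -/
theorem HasWeakDeriv.unique (hg : IntegrableOn g (Ioo a b)) (hg' : IntegrableOn g' (Ioo a b))
    (h : HasWeakDeriv a b f g) (h' : HasWeakDeriv a b f g') :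
    g =ᵐ[volume.restrict (Ioo a b)] g' := by
  have key : ∀ᵐ x ∂(volume : Measure ℝ), x ∈ Ioo a b → (g - g') x = 0 := by
    refine isOpen_Ioo.ae_eq_zero_of_integral_contDiff_smul_eq_zero
      (hg.sub hg').locallyIntegrableOn ?_
    intro φ h1 h2 h3
    have e : ∫ x, φ x • (g - g') x = ∫ x in Ioo a b, φ x • (g - g') x := by
      rw [setIntegral_eq_integral_of_forall_compl_eq_zero]
      intro x hx
      rw [image_eq_zero_of_notMem_tsupport (fun hh => hx (h3 hh)), zero_smul]
    rw [e]
    simp only [Pi.sub_apply, smul_sub]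
    rw [integral_sub (integrable_smul_of_test h1.continuous h2 hg)
      (integrable_smul_of_test h1.continuous h2 hg'), sub_eq_zero]
    have := (h φ h1 h2 h3).symm.trans (h' φ h1 h2 h3)
    exact neg_injective this
  rw [EventuallyEq, ae_restrict_iff' measurableSet_Ioo]
  filter_upwards [key] with x hx hx'
  exact sub_eq_zero.mp (hx hx')

/-- A function whose weak derivative vanishes is almost everywhere constant. -/
theorem HasWeakDeriv.ae_const (hab : a < b) (hf : IntegrableOn f (Ioo a b))
    (h : HasWeakDeriv a b f 0) : ∃ c : ℂ, f =ᵐ[volume.restrict (Ioo a b)] fun _ => c := by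
  -- a bump function of integral one supported in the interval
  have hr : 0 < (b - a) / 8 := by linarith
  let β : ContDiffBump ((a + b) / 2) := ⟨(b - a) / 8, (b - a) / 4, hr, by linarith⟩
  let η : ℝ → ℝ := β.normed volume
  have η1 : ContDiff ℝ ∞ η := β.contDiff_normed
  have η2 : HasCompactSupport η := β.hasCompactSupport_normed
  have η3 : tsupport η ⊆ Ioo a b := by
    rw [show tsupport η = _ from β.tsupport_normed_eq]
    intro x hx
    simp only [Metric.mem_closedBall, Real.dist_eq, β] at hx
    rw [abs_le] at hx
    constructor <;> linarith
  have η4 : ∫ x, η x = 1 := β.integral_normed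
  refine ⟨∫ x in Ioo a b, η x • f x, ?_⟩
  set c := ∫ x in Ioo a b, η x • f x with hc
  have hconst : IntegrableOn (fun _ : ℝ => c) (Ioo a b) := by simp
  have key : ∀ᵐ x ∂(volume : Measure ℝ), x ∈ Ioo a b → (f - (fun _ : ℝ => c)) x = 0 := by
    refine isOpen_Ioo.ae_eq_zero_of_integral_contDiff_smul_eq_zero
      (hf.sub hconst).locallyIntegrableOn ?_
    intro ψ h1 h2 h3
    let I : ℝ := ∫ x, ψ x
    let θ : ℝ → ℝ := fun x => ψ x - I * η x
    have θ1 : ContDiff ℝ ∞ θ := h1.sub (contDiff_const.mul η1)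
    have θc : Continuous θ := θ1.continuous
    obtain ⟨a', b', ha', hb', hs⟩ : ∃ a' b', a < a' ∧ b' < b ∧ a' < b' ∧
        ∀ x, x ∉ Icc a' b' → θ x = 0 := by
      have hcomp : IsCompact (tsupport ψ ∪ tsupport η) := h2.isCompact.union η2.isCompact
      have hne : (tsupport ψ ∪ tsupport η).Nonempty := by
        by_contra hemp
        rw [not_nonempty_iff_eq_empty, union_empty_iff] at hemp
        have : η = 0 := tsupport_eq_empty_iff.mp hemp.2
        rw [this] at η4
        simp at η4
      have hsub : tsupport ψ ∪ tsupport η ⊆ Ioo a b := union_subset h3 η3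
      have m1 := hsub (hcomp.sInf_mem hne)
      have m2 := hsub (hcomp.sSup_mem hne)
      refine ⟨(a + sInf (tsupport ψ ∪ tsupport η)) / 2,
        (b + sSup (tsupport ψ ∪ tsupport η)) / 2, ?_, ?_, ?_, ?_⟩
      · linarith [m1.1]
      · linarith [m2.2]
      · have := (csInf_le hcomp.bddBelow hne.some_mem).trans
          (le_csSup hcomp.bddAbove hne.some_mem)
        linarith [m1.1, m2.2]
      · intro x hx
        have hx' : x ∉ tsupport ψ ∪ tsupport η := by
          intro hm
          apply hx
          have i1 := csInf_le hcomp.bddBelow hm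
          have i2 := le_csSup hcomp.bddAbove hm
          constructor
          · linarith [m1.1]
          · linarith [m2.2]
        have z1 : ψ x = 0 := image_eq_zero_of_notMem_tsupport (fun hh => hx' (Or.inl hh))
        have z2 : η x = 0 := image_eq_zero_of_notMem_tsupport (fun hh => hx' (Or.inr hh))
        simp [θ, z1, z2]
    obtain ⟨hab', hs⟩ := hs
    have θint : Integrable θ :=
      (h1.continuous.integrable_of_hasCompactSupport h2).sub
        ((η1.continuous.integrable_of_hasCompactSupport η2).const_mul I)
    have θ0 : ∫ x, θ x = 0 := by
      rw [integral_sub (h1.continuous.integrable_of_hasCompactSupport h2)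
        ((η1.continuous.integrable_of_hasCompactSupport η2).const_mul I),
        integral_const_mul, η4]
      simp [I]
    let Φ : ℝ → ℝ := fun x => ∫ t in a..x, θ t
    have Φd : ∀ x, HasDerivAt Φ (θ x) x := fun x =>
      intervalIntegral.integral_hasDerivAt_right (θc.intervalIntegrable _ _)
        θc.aestronglyMeasurable.stronglyMeasurableAtFilter θc.continuousAt
    have Φderiv : deriv Φ = θ := funext fun x => (Φd x).deriv
    have Φ1 : ContDiff ℝ ∞ Φ := by
      rw [contDiff_infty_iff_deriv]
      exact ⟨fun x => (Φd x).differentiableAt, by rw [Φderiv]; exact θ1⟩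
    have Φ0 : ∀ x, x ∉ Icc a' b' → Φ x = 0 := by
      intro x hx
      by_cases hxa : x < a'
      · refine intervalIntegral.integral_zero_ae (Eventually.of_forall ?_)
        intro t ht
        apply hs
        intro hh
        have : t ≤ max a x := (mem_Ioc.mp ht).2
        have := lt_of_le_of_lt this (max_lt ha' hxa)
        linarith [hh.1]
      · have hxb : b' < x := by
          by_contra hcon
          exact hx ⟨not_lt.mp hxa, not_lt.mp hcon⟩
        have hax : a ≤ x := by linarith
        show ∫ t in a..x, θ t = 0
        rw [intervalIntegral.integral_of_le hax, setIntegral_eq_integral_of_forall_compl_eq_zero,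
          θ0]
        intro t ht
        apply hs
        intro hh
        exact ht ⟨by linarith [hh.1], by linarith [hh.2]⟩
    have Φs : tsupport Φ ⊆ Icc a' b' := by
      refine closure_minimal ?_ isClosed_Icc
      intro x hx
      by_contra hcon
      exact hx (Φ0 x hcon)
    have Φ2 : HasCompactSupport Φ := isCompact_Icc.of_isClosed_subset (isClosed_tsupport _) Φs
    have Φ3 : tsupport Φ ⊆ Ioo a b := fun x hx =>
      ⟨lt_of_lt_of_le ha' (Φs hx).1, lt_of_le_of_lt (Φs hx).2 hb'⟩
    have main := h Φ Φ1 Φ2 Φ3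
    rw [Φderiv] at main
    simp only [Pi.zero_apply, smul_zero, integral_zero, neg_zero] at main
    have e : ∫ x, ψ x • (f - (fun _ : ℝ => c)) x = ∫ x in Ioo a b, ψ x • (f - (fun _ : ℝ => c)) x := by
      rw [setIntegral_eq_integral_of_forall_compl_eq_zero]
      intro x hx
      rw [image_eq_zero_of_notMem_tsupport (fun hh => hx (h3 hh)), zero_smul]
    have eI : ∫ x in Ioo a b, ψ x = I := by
      rw [setIntegral_eq_integral_of_forall_compl_eq_zero]
      intro x hx
      exact image_eq_zero_of_notMem_tsupport (fun hh => hx (h3 hh))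
    have i1 := integrable_smul_of_test h1.continuous h2 hf
    have i2 := integrable_smul_of_test η1.continuous η2 hf
    have i3 := integrable_smul_of_test h1.continuous h2 hconst
    rw [e]
    simp only [Pi.sub_apply, smul_sub]
    rw [integral_sub i1 i3]
    have e4 : ∫ x in Ioo a b, ψ x • c = (I : ℂ) * c := by
      rw [integral_smul_const, eI, Complex.real_smul]
    have e5 : ∫ x in Ioo a b, θ x • f x = (∫ x in Ioo a b, ψ x • f x) - (I : ℂ) * c := by
      rw [hc, ← integral_const_mul, ← integral_sub i1 (i2.const_mul _)]
      congr 1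
      ext x
      simp only [θ, Complex.real_smul]
      push_cast
      ring
    rw [e4, ← e5, main]
  rw [EventuallyEq, ae_restrict_iff' measurableSet_Ioo]
  filter_upwards [key] with x hx hx'
  exact sub_eq_zero.mp (hx hx')

theorem absolutelyContinuous_primitive (hab : a < b) (hg : IntegrableOn g (Ioo a b)) :
    AbsolutelyContinuousOnInterval (fun x => ∫ t in a..x, g t) a b := by
  have hi : IntervalIntegrable g volume a b :=
    (intervalIntegrable_iff_integrableOn_Ioo_of_le hab.le).mpr hg
  have hN := hi.norm.absolutelyContinuousOnInterval_intervalIntegral (c := a) left_mem_uIcc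
  rw [AbsolutelyContinuousOnInterval] at hN ⊢
  refine squeeze_zero' (Eventually.of_forall fun _ => Finset.sum_nonneg fun _ _ => dist_nonneg)
    ?_ hN
  have hmem : ∀ᶠ E in AbsolutelyContinuousOnInterval.totalLengthFilter ⊓
      𝓟 (AbsolutelyContinuousOnInterval.disjWithin a b),
      E ∈ AbsolutelyContinuousOnInterval.disjWithin a b :=
    eventually_inf_principal.mpr (by simp)
  filter_upwards [hmem] with E hE
  refine Finset.sum_le_sum fun i hi' => ?_
  have hE1 := hE.1 i hi'
  have s1 : IntervalIntegrable g volume a (E.2 i).1 :=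
    hi.mono_set (uIcc_subset_uIcc_left hE1.1)
  have s2 : IntervalIntegrable g volume a (E.2 i).2 :=
    hi.mono_set (uIcc_subset_uIcc_left hE1.2)
  rw [dist_eq_norm, dist_eq_norm, intervalIntegral.integral_interval_sub_left s1 s2,
    intervalIntegral.integral_interval_sub_left s1.norm s2.norm, Real.norm_eq_abs]
  exact intervalIntegral.norm_integral_le_abs_integral_norm

theorem integral_eq_of_ae_hasDerivAt {F : ℝ → ℂ} (hab : a < b)
    (hF : AbsolutelyContinuousOnInterval F a b)
    (hd : ∀ᵐ x, x ∈ uIcc a b → HasDerivAt F (g x) x) (hg : IntegrableOn g (Ioo a b)) :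
    ∫ x in Ioo a b, g x = F b - F a := by
  have hi : IntervalIntegrable g volume a b :=
    (intervalIntegrable_iff_integrableOn_Ioo_of_le hab.le).mpr hg
  obtain ⟨C, hC⟩ := (hF.sub (absolutelyContinuous_primitive hab hg)).const_of_ae_hasDerivAt_zero
    (by
      filter_upwards [hd, hi.ae_hasDerivAt_integral] with x h1 h2 hx
      have := (h1 hx).sub (h2 hx a left_mem_uIcc)
      rwa [sub_self] at this)
  have ha := hC a left_mem_uIcc
  have hb := hC b right_mem_uIcc
  simp only [Pi.sub_apply, intervalIntegral.integral_same, sub_zero] at ha hb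
  rw [ha, ← hb, ← integral_Ioc_eq_integral_Ioo, ← intervalIntegral.integral_of_le hab.le]
  ring

theorem test_absolutelyContinuous {φ : ℝ → ℝ} (h1 : ContDiff ℝ ∞ φ) :
    AbsolutelyContinuousOnInterval (fun x => (φ x : ℂ)) a b := by
  have hd : ContDiff ℝ ∞ (fun x => (φ x : ℂ)) := Complex.ofRealCLM.contDiff.comp h1
  obtain ⟨K, hK⟩ := hd.contDiffOn.exists_lipschitzOnWith (s := uIcc a b) (by simp)
    (convex_uIcc a b) isCompact_uIcc
  exact hK.absolutelyContinuousOnInterval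

/-- Integration by parts of a test function against an absolutely continuous function. -/
theorem hasWeakDeriv_of_absolutelyContinuous {F : ℝ → ℂ} (hab : a < b)
    (hF : AbsolutelyContinuousOnInterval F a b)
    (hd : ∀ᵐ x, x ∈ uIcc a b → HasDerivAt F (g x) x) (hg : IntegrableOn g (Ioo a b)) :
    HasWeakDeriv a b F g := by
  intro φ h1 h2 h3
  have c2 : Continuous (deriv φ) := h1.continuous_deriv (by simp)
  have hFi : IntegrableOn F (Ioo a b) := by
    have := hF.continuousOn
    rw [uIcc_of_le hab.le] at this
    exact (this.integrableOn_compact isCompact_Icc).mono_set Ioo_subset_Icc_self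
  have i1 := integrable_smul_of_test c2 h2.deriv hFi
  have i2 := integrable_smul_of_test h1.continuous h2 hg
  have ha : φ a = 0 := image_eq_zero_of_notMem_tsupport (fun hh => lt_irrefl _ (h3 hh).1)
  have hb : φ b = 0 := image_eq_zero_of_notMem_tsupport (fun hh => lt_irrefl _ (h3 hh).2)
  have key := integral_eq_of_ae_hasDerivAt (g := fun x => deriv φ x • F x + φ x • g x) hab
    ((test_absolutelyContinuous h1).smul hF)
    (by
      filter_upwards [hd] with x hx hx'
      have d1 : HasDerivAt (fun x => (φ x : ℂ)) ((deriv φ x : ℝ) : ℂ) x :=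
        ((h1.differentiable (by simp)) x).hasDerivAt.ofReal_comp
      have := d1.smul (hx hx')
      convert! this using 1
      simp only [Complex.real_smul, smul_eq_mul]
      ring)
    (i1.add i2)
  rw [integral_add i1 i2] at key
  simp only [Pi.smul_apply', ha, hb, Complex.ofReal_zero, zero_smul, sub_zero] at key
  exact eq_neg_of_add_eq_zero_left key

/-- A function with an integrable weak derivative has an absolutely continuous representative. -/
theorem HasWeakDeriv.exists_absolutelyContinuous (hab : a < b) (hf : IntegrableOn f (Ioo a b))
    (hg : IntegrableOn g (Ioo a b)) (h : HasWeakDeriv a b f g) :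
    ∃ F : ℝ → ℂ, AbsolutelyContinuousOnInterval F a b ∧
      (∀ᵐ x, x ∈ uIcc a b → HasDerivAt F (g x) x) ∧ f =ᵐ[volume.restrict (Ioo a b)] F := by
  have hi : IntervalIntegrable g volume a b :=
    (intervalIntegrable_iff_integrableOn_Ioo_of_le hab.le).mpr hg
  have hP := absolutelyContinuous_primitive hab hg
  set P : ℝ → ℂ := fun x => ∫ t in a..x, g t with hPdef
  have hPd : ∀ᵐ x, x ∈ uIcc a b → HasDerivAt P (g x) x := by
    filter_upwards [hi.ae_hasDerivAt_integral] with x h2 hx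
    exact h2 hx a left_mem_uIcc
  have hPi : IntegrableOn P (Ioo a b) := by
    have := hP.continuousOn
    rw [uIcc_of_le hab.le] at this
    exact (this.integrableOn_compact isCompact_Icc).mono_set Ioo_subset_Icc_self
  have hPw := hasWeakDeriv_of_absolutelyContinuous hab hP hPd hg
  have h0 : HasWeakDeriv a b (fun x => f x + (-1) * P x) 0 := by
    refine (h.add hf hg (hPi.const_mul _) (hg.const_mul _) (hPw.const_mul (-1))).congr
      (EventuallyEq.refl _ _) (Eventually.of_forall fun x => ?_)
    simp
  obtain ⟨c, hc⟩ := h0.ae_const hab (hf.add (hPi.const_mul _))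
  refine ⟨fun x => P x + c, ?_, ?_, ?_⟩
  · have hcc : AbsolutelyContinuousOnInterval (fun _ : ℝ => c) a b :=
      (LipschitzWith.const c).lipschitzOnWith.absolutelyContinuousOnInterval
    exact hP.add hcc
  · filter_upwards [hPd] with x hx hx'
    exact (hx hx').add_const c
  · filter_upwards [hc] with x hx
    rw [← hx]
    simp only [Pi.add_apply]
    ring

theorem HasWeakDeriv.exists_bound (hab : a < b) (hf : IntegrableOn f (Ioo a b))
    (hg : IntegrableOn g (Ioo a b)) (h : HasWeakDeriv a b f g) :
    ∃ C : ℝ, ∀ᵐ x ∂(volume.restrict (Ioo a b)), ‖f x‖ ≤ C := by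
  obtain ⟨F, hF, -, hfF⟩ := h.exists_absolutelyContinuous hab hf hg
  obtain ⟨C, hC⟩ := hF.exists_bound
  refine ⟨C, ?_⟩
  filter_upwards [hfF, ae_restrict_mem measurableSet_Ioo] with x hx hx'
  rw [hx]
  refine hC x ?_
  rw [uIcc_of_le hab.le]
  exact Ioo_subset_Icc_self hx'

/-- The product rule for weak derivatives. -/
theorem HasWeakDeriv.mul (hab : a < b) (hf : IntegrableOn f (Ioo a b))
    (hg : IntegrableOn g (Ioo a b)) (hf' : IntegrableOn f' (Ioo a b))
    (hg' : IntegrableOn g' (Ioo a b)) (h : HasWeakDeriv a b f g)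
    (h' : HasWeakDeriv a b f' g') :
    HasWeakDeriv a b (fun x => f x * f' x) (fun x => g x * f' x + f x * g' x) := by
  obtain ⟨F, hF, hFd, hfF⟩ := h.exists_absolutelyContinuous hab hf hg
  obtain ⟨G, hG, hGd, hfG⟩ := h'.exists_absolutelyContinuous hab hf' hg'
  obtain ⟨C, hC⟩ := h.exists_bound hab hf hg
  obtain ⟨D, hD⟩ := h'.exists_bound hab hf' hg'
  have j1 : IntegrableOn (fun x => g x * f' x) (Ioo a b) := hg.mul_bdd hf'.1 hD
  have j2 : IntegrableOn (fun x => f x * g' x) (Ioo a b) := hg'.bdd_mul hf.1 hC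
  have e1 : (fun x => f x * f' x) =ᵐ[volume.restrict (Ioo a b)] fun x => F x * G x := by
    filter_upwards [hfF, hfG] with x h1 h2
    rw [h1, h2]
  have e2 : (fun x => g x * f' x + f x * g' x) =ᵐ[volume.restrict (Ioo a b)]
      fun x => g x * G x + F x * g' x := by
    filter_upwards [hfF, hfG] with x h1 h2
    rw [h1, h2]
  refine (hasWeakDeriv_of_absolutelyContinuous (F := fun x => F x * G x)
    (g := fun x => g x * G x + F x * g' x) hab (hF.smul hG) ?_ ?_).congr e1.symm e2.symm
  · filter_upwards [hFd, hGd] with x h1 h2 hx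
    exact (h1 hx).mul (h2 hx)
  · exact Integrable.congr (j1.add j2) e2

end WeakDerivative

section SobolevSpace

/-- The complex Lebesgue space `L_p` on the interval `(a, b)`. -/
abbrev LpI (a b : ℝ) (p : ℝ≥0∞) : Type :=
  Lp ℂ p (volume.restrict (Ioo a b))

variable {a b : ℝ} {p : ℝ≥0∞} {n : ℕ}

/-- `f` is (a representative of) a function of class `W_p^n`. -/
def IsSob (a b : ℝ) (p : ℝ≥0∞) : ℕ → (ℝ → ℂ) → Prop
  | 0, f => MemLp f p (volume.restrict (Ioo a b))
  | n + 1, f => MemLp f p (volume.restrict (Ioo a b)) ∧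
      ∃ g, HasWeakDeriv a b f g ∧ IsSob a b p n g

theorem IsSob.memLp {f : ℝ → ℂ} : ∀ {n : ℕ}, IsSob a b p n f →
    MemLp f p (volume.restrict (Ioo a b))
  | 0, h => h
  | _ + 1, h => h.1

theorem IsSob.of_succ {f : ℝ → ℂ} : ∀ {n : ℕ}, IsSob a b p (n + 1) f → IsSob a b p n f := by
  intro n
  induction n generalizing f with
  | zero => exact fun h => h.1
  | succ n ih =>
    rintro ⟨h, g, hg, hg'⟩
    exact ⟨h, g, hg, ih hg'⟩

theorem IsSob.of_le {f : ℝ → ℂ} {k : ℕ} (hk : k ≤ n) (h : IsSob a b p n f) : IsSob a b p k f := by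
  induction n, hk using Nat.le_induction with
  | base => exact h
  | succ n _ ih => exact ih h.of_succ

theorem IsSob.zero : ∀ n : ℕ, IsSob a b p n (fun _ => 0) := by
  intro n
  induction n with
  | zero => exact MemLp.zero'
  | succ n ih =>
    refine ⟨MemLp.zero', fun _ => 0, ?_, ih⟩
    intro φ _ _ _
    simp

theorem memLp_mul_of_bound {f g : ℝ → ℂ} {C : ℝ} (hf : MemLp f p (volume.restrict (Ioo a b)))
    (hg : AEStronglyMeasurable g (volume.restrict (Ioo a b)))
    (hC : ∀ᵐ x ∂(volume.restrict (Ioo a b)), ‖g x‖ ≤ C) :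
    MemLp (fun x => f x * g x) p (volume.restrict (Ioo a b)) := by
  refine MemLp.of_le_mul (c := C) hf (hf.1.mul hg) ?_
  filter_upwards [hC] with x hx
  rw [norm_mul, mul_comm]
  exact mul_le_mul_of_nonneg_right hx (norm_nonneg _)

variable [Fact (1 ≤ p)]

theorem LpI.integrableOn (f : LpI a b p) : IntegrableOn f (Ioo a b) :=
  (Lp.memLp f).integrable Fact.out

/-- The complex Sobolev space `W_p^n` on `(a, b)`. An element is stored together with its weak
derivatives: it is a tuple `(f, f', …, f^(n))` of elements of `L_p`, each of which is the weak
derivative of the preceding one (the tuple is determined by its first entry). The norm is the sum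
of the `L_p` norms of the entries. -/
def sobolev (a b : ℝ) (p : ℝ≥0∞) [Fact (1 ≤ p)] (n : ℕ) :
    Submodule ℂ (PiLp 1 (fun _ : Fin (n + 1) => LpI a b p)) where
  carrier := {F | ∀ k : Fin n, HasWeakDeriv a b (F k.castSucc) (F k.succ)}
  add_mem' := by
    intro F G hF hG k
    refine ((hF k).add (LpI.integrableOn _) (LpI.integrableOn _) (LpI.integrableOn _)
      (LpI.integrableOn _) (hG k)).congr ?_ ?_
    · exact (Lp.coeFn_add _ _).symm
    · exact (Lp.coeFn_add _ _).symm
  zero_mem' := by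
    intro k φ h1 h2 h3
    have e : ((0 : LpI a b p) : ℝ → ℂ) =ᵐ[volume.restrict (Ioo a b)] 0 := Lp.coeFn_zero _ _ _
    have e1 (ψ : ℝ → ℝ) : ∫ x in Ioo a b, ψ x • (0 : LpI a b p) x = 0 := by
      refine integral_eq_zero_of_ae ?_
      filter_upwards [e] with x hx
      rw [hx]
      simp
    simp only [PiLp.zero_apply, e1, neg_zero]
  smul_mem' := by
    intro c F hF k
    refine ((hF k).const_mul c).congr ?_ ?_
    · exact (Lp.coeFn_smul c (F k.castSucc)).symm
    · exact (Lp.coeFn_smul c (F k.succ)).symm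

/-- The Sobolev space `W_p^n` as a normed space. -/
abbrev Sob (a b : ℝ) (p : ℝ≥0∞) [Fact (1 ≤ p)] (n : ℕ) : Type := sobolev a b p n

/-- The `k`-th (weak) derivative of a Sobolev function, `k ≤ n`; `k = 0` gives the function
itself. -/
def Sob.D (F : Sob a b p n) (k : Fin (n + 1)) : LpI a b p := F.1 k

theorem Sob.norm_eq (F : Sob a b p n) : ‖F‖ = ∑ k, ‖F.D k‖ := by
  rw [← Submodule.norm_coe, PiLp.norm_eq_of_nat 1 (by simp)]
  simp [Sob.D]

/-- A Sobolev function is determined by its values almost everywhere. -/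
theorem Sob.ext_of_ae {F G : Sob a b p n}
    (h : F.D 0 =ᵐ[volume.restrict (Ioo a b)] G.D 0) : F = G := by
  have key : ∀ k : Fin (n + 1), F.1 k = G.1 k := by
    intro k
    induction k using Fin.induction with
    | zero => exact Lp.ext h
    | succ k ih =>
      refine Lp.ext (HasWeakDeriv.unique (LpI.integrableOn _) (LpI.integrableOn _) (F.2 k) ?_)
      rw [ih]
      exact G.2 k
  exact Subtype.ext (PiLp.ext key)

theorem IsSob.integrableOn {f : ℝ → ℂ} (h : IsSob a b p n f) : IntegrableOn f (Ioo a b) :=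
  h.memLp.integrable Fact.out

theorem IsSob.add {f g : ℝ → ℂ} : ∀ {n : ℕ}, IsSob a b p n f → IsSob a b p n g →
    IsSob a b p n (fun x => f x + g x) := by
  intro n
  induction n generalizing f g with
  | zero => exact fun hf hg => MemLp.add hf hg
  | succ n ih =>
    rintro ⟨hf, f', hf', hf''⟩ ⟨hg, g', hg', hg''⟩
    have i1 : IntegrableOn f (Ioo a b) := hf.integrable Fact.out
    have i2 : IntegrableOn g (Ioo a b) := hg.integrable Fact.out
    exact ⟨hf.add hg, _, hf'.add i1 hf''.integrableOn i2 hg''.integrableOn hg', ih hf'' hg''⟩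

theorem IsSob.sum {ι : Type*} (s : Finset ι) {f : ι → ℝ → ℂ}
    (h : ∀ i ∈ s, IsSob a b p n (f i)) : IsSob a b p n (fun x => ∑ i ∈ s, f i x) := by
  classical
  induction s using Finset.induction_on with
  | empty => simpa using IsSob.zero n
  | insert i s hi ih =>
    simp only [Finset.sum_insert hi]
    exact (h i (Finset.mem_insert_self i s)).add
      (ih fun j hj => h j (Finset.mem_insert_of_mem hj))

/-- The product of a function of class `W_p^n` and one of class `W_p^(n+1)` is of class
`W_p^n`. -/
theorem IsSob.mul (hab : a < b) {f g : ℝ → ℂ} : ∀ {n : ℕ}, IsSob a b p n f →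
    IsSob a b p (n + 1) g → IsSob a b p n (fun x => f x * g x) := by
  intro n
  induction n generalizing f g with
  | zero =>
    intro hf hg
    obtain ⟨hg, g', h1, h2⟩ := hg
    obtain ⟨C, hC⟩ := h1.exists_bound hab (hg.integrable Fact.out) h2.integrableOn
    exact memLp_mul_of_bound hf hg.1 hC
  | succ n ih =>
    intro hf hg
    have h0 : IsSob a b p 0 (fun x => f x * g x) := by
      obtain ⟨hg, g', h1, h2⟩ := hg
      obtain ⟨C, hC⟩ := h1.exists_bound hab (hg.integrable Fact.out) h2.integrableOn
      exact memLp_mul_of_bound hf.memLp hg.1 hC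
    obtain ⟨f1, f', hf', hf''⟩ := id hf
    obtain ⟨g1, g', hg', hg''⟩ := id hg
    exact ⟨h0, _, hf'.mul hab hf.integrableOn hf''.integrableOn hg.integrableOn
      hg''.integrableOn hg', (ih hf'' hg.of_succ).add (ih hf.of_succ hg'')⟩

theorem Sob.isSob_D (F : Sob a b p n) : ∀ (l k : ℕ) (h : k + l = n),
    IsSob a b p l (F.D ⟨k, by omega⟩)
  | 0, _, _ => Lp.memLp _
  | l + 1, k, h =>
    ⟨Lp.memLp _, F.D ⟨k + 1, by omega⟩, F.2 ⟨k, by omega⟩, F.isSob_D l (k + 1) (by omega)⟩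

theorem IsSob.exists_sob {f : ℝ → ℂ} (h : IsSob a b p n f) :
    ∃ F : Sob a b p n, F.D 0 =ᵐ[volume.restrict (Ioo a b)] f := by
  have key : ∀ (n : ℕ) (f : ℝ → ℂ), IsSob a b p n f → ∃ G : Fin (n + 1) → LpI a b p,
      (∀ k : Fin n, HasWeakDeriv a b (G k.castSucc) (G k.succ)) ∧
      G 0 =ᵐ[volume.restrict (Ioo a b)] f := by
    intro n
    induction n with
    | zero =>
      intro f h
      exact ⟨fun _ => MemLp.toLp f h, fun k => k.elim0, MemLp.coeFn_toLp h⟩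
    | succ n ih =>
      rintro f ⟨hf, g, hg, hg'⟩
      obtain ⟨G, hG, hG0⟩ := ih g hg'
      refine ⟨Fin.cons (MemLp.toLp f hf) G, ?_, MemLp.coeFn_toLp hf⟩
      intro k
      induction k using Fin.cases with
      | zero => exact hg.congr (MemLp.coeFn_toLp hf).symm hG0.symm
      | succ k => exact hG k
  obtain ⟨G, hG, hG0⟩ := key n f h
  exact ⟨⟨WithLp.toLp 1 G, hG⟩, hG0⟩

end SobolevSpace

section BoundaryValueProblem

variable {a b : ℝ} {p : ℝ≥0∞} [Fact (1 ≤ p)] {m n r : ℕ}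

/-- The space `(W_p^n)^m` of vector-valued functions with `m` components in `W_p^n`. The norm is
the sum of the norms of the components. -/
abbrev VSob (a b : ℝ) (p : ℝ≥0∞) [Fact (1 ≤ p)] (m n : ℕ) : Type :=
  PiLp 1 (fun _ : Fin m => Sob a b p n)

/-- The space `(W_p^n)^{m×m}` of matrix-valued functions. -/
abbrev MSob (a b : ℝ) (p : ℝ≥0∞) [Fact (1 ≤ p)] (m n : ℕ) : Type :=
  Matrix (Fin m) (Fin m) (Sob a b p n)

/-- The norm of `(W_p^n)^{m×m}`: the sum of the norms of the entries. -/
noncomputable def mnorm (M : MSob a b p m n) : ℝ := ∑ i, ∑ l, ‖M i l‖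

/-- The `i`-th component of the function
`t ↦ y^(r)(t) + A_{r-1}(t) y^(r-1)(t) + ⋯ + A_0(t) y(t)`. -/
noncomputable def diffExpr (A : Fin r → MSob a b p m n) (y : VSob a b p m (n + r)) (i : Fin m)
    (t : ℝ) : ℂ :=
  (y i).D ⟨r, by omega⟩ t +
    ∑ k : Fin r, ∑ l : Fin m, (A k i l).D 0 t * (y l).D ⟨k, by omega⟩ t

theorem exists_diffOp (A : Fin r → MSob a b p m n) (y : VSob a b p m (n + r)) :
    ∃ g : VSob a b p m n, ∀ i,
      (g i).D 0 =ᵐ[volume.restrict (Ioo a b)] diffExpr A y i := by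
  rcases lt_or_ge a b with hab | hab
  · have h : ∀ i, IsSob a b p n (diffExpr A y i) := by
      intro i
      refine ((y i).isSob_D n r (by omega)).add
        (IsSob.sum _ fun k _ => IsSob.sum _ fun l _ => IsSob.mul hab ?_ ?_)
      · exact (A k i l).isSob_D n 0 (by omega)
      · exact ((y l).isSob_D (n + r - k) k (by omega)).of_le (by omega)
    choose g hg using fun i => (h i).exists_sob
    exact ⟨WithLp.toLp 1 g, hg⟩
  · refine ⟨0, fun i => ?_⟩
    have h0 : ∀ s, volume.restrict (Ioo a b) s = 0 := fun s => by simp [hab]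
    exact ae_iff.mpr (h0 _)

/-- The differential operator `L : (W_p^(n+r))^m → (W_p^n)^m`,
`L y = y^(r) + A_{r-1} y^(r-1) + ⋯ + A_0 y`; it is characterised by `eq_diffOp_iff`. -/
noncomputable def diffOp (A : Fin r → MSob a b p m n) (y : VSob a b p m (n + r)) :
    VSob a b p m n :=
  Classical.choose (exists_diffOp A y)

theorem diffOp_ae_eq (A : Fin r → MSob a b p m n) (y : VSob a b p m (n + r)) (i : Fin m) :
    (diffOp A y i).D 0 =ᵐ[volume.restrict (Ioo a b)] diffExpr A y i :=
  Classical.choose_spec (exists_diffOp A y) i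

theorem eq_diffOp_iff (A : Fin r → MSob a b p m n) (y : VSob a b p m (n + r))
    (g : VSob a b p m n) :
    g = diffOp A y ↔ ∀ i, (g i).D 0 =ᵐ[volume.restrict (Ioo a b)] diffExpr A y i := by
  constructor
  · rintro rfl
    exact diffOp_ae_eq A y
  · intro h
    exact PiLp.ext fun i => Sob.ext_of_ae ((h i).trans (diffOp_ae_eq A y i).symm)

/-- `y` is a solution of the boundary-value problem `L y = f`, `B y = c`. -/
def IsSolution (A : Fin r → MSob a b p m n)
    (B : VSob a b p m (n + r) →L[ℂ] EuclideanSpace ℂ (Fin (r * m)))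
    (f : VSob a b p m n) (c : EuclideanSpace ℂ (Fin (r * m))) (y : VSob a b p m (n + r)) : Prop :=
  diffOp A y = f ∧ B y = c

/-- The homogeneous problem at the parameter value `0` has only the trivial
solution. -/
def Condition0 (A : ℝ → Fin r → MSob a b p m n)
    (B : ℝ → VSob a b p m (n + r) →L[ℂ] EuclideanSpace ℂ (Fin (r * m))) : Prop :=
  ∀ y, IsSolution (A 0) (B 0) 0 0 y → y = 0

/-- Every coefficient converges in `(W_p^n)^{m×m}` as `ε → 0+`. -/
def LimitConditionI (A : ℝ → Fin r → MSob a b p m n) : Prop :=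
  ∀ k, Tendsto (fun ε => mnorm (A ε k - A 0 k)) (𝓝[>] 0) (𝓝 0)

/-- Strong convergence of the boundary operators as `ε → 0+`. -/
def LimitConditionII
    (B : ℝ → VSob a b p m (n + r) →L[ℂ] EuclideanSpace ℂ (Fin (r * m))) : Prop :=
  ∀ y, Tendsto (fun ε => B ε y) (𝓝[>] 0) (𝓝 (B 0 y))

/-- The discrepancy `‖L u - f‖_{n,p} + ‖B u - c‖` of a function `u`. -/
noncomputable def discrepancy (A : Fin r → MSob a b p m n)
    (B : VSob a b p m (n + r) →L[ℂ] EuclideanSpace ℂ (Fin (r * m)))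
    (f : VSob a b p m n) (c : EuclideanSpace ℂ (Fin (r * m))) (u : VSob a b p m (n + r)) : ℝ :=
  ‖diffOp A u - f‖ + ‖B u - c‖

end BoundaryValueProblem

end GenericBVP

open GenericBVP

/-! Write `T ε = (L(ε), B(ε))`. Since `T ε (y 0 - y ε) = (L(ε) y 0 - f ε, B(ε) y 0 - c ε)`, the
discrepancy is the norm of the image of the error. Both estimates therefore say that `T ε` is
bounded above and below, uniformly for small `ε > 0`. This is `eventually_norm_equiv`.

At `ε = 0` the operator is a bounded bijection of Banach spaces. Carathéodory's theorem for the
equivalent first-order system makes `L` surjective with kernel of dimension `r * m`, so injectivity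
of the boundary-value problem already gives unique solvability (`existsUnique_isSolution`), and the
open mapping theorem bounds the inverse `S`.

The coefficients converge in the norm of `W_p^n`, and multiplication `W_p^n × W_p^(n+1) → W_p^n` is
bounded (`Sob.exists_mul`), so `L(ε) → L(0)` in operator norm. The boundary operators converge only
strongly, hence `T ε → T 0` in norm is not available. Two weaker facts suffice: `B(ε)` is bounded
uniformly near `0` by Banach–Steinhaus, and on the finite-dimensional space `S (0 × ℂ^(rm)) = ker
L(0)` strong convergence is norm convergence. The component of `y` outside this kernel is controlled
by `L(0) y` alone, so there a bounded error is harmless.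

The lower bound also makes `T ε` injective, and unique solvability for small `ε > 0` follows as at
`ε = 0`. -/

namespace GenericBVP

/-! ### Primitives and the embedding of `W_p^1` into `L_∞`. -/

section Embedding

variable {a b : ℝ} {p : ℝ≥0∞} [Fact (1 ≤ p)] {n : ℕ}

theorem LpI.exists_integral_norm_le (a b : ℝ) (p : ℝ≥0∞) [Fact (1 ≤ p)] :
    ∃ C : ℝ, 0 ≤ C ∧ ∀ u : LpI a b p, ∫ x in Ioo a b, ‖u x‖ ≤ C * ‖u‖ := by
  refine ⟨((volume.restrict (Ioo a b)) univ ^ (1 / (1 : ℝ≥0∞).toReal - 1 / p.toReal)).toReal,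
    ENNReal.toReal_nonneg, fun u => ?_⟩
  have h := eLpNorm_le_eLpNorm_mul_rpow_measure_univ (μ := volume.restrict (Ioo a b))
    (Fact.out : (1 : ℝ≥0∞) ≤ p) (Lp.aestronglyMeasurable u)
  rw [integral_norm_eq_lintegral_enorm (Lp.aestronglyMeasurable u), ← eLpNorm_one_eq_lintegral_enorm,
    Lp.norm_def, mul_comm, ← ENNReal.toReal_mul]
  refine ENNReal.toReal_mono (ENNReal.mul_ne_top (Lp.eLpNorm_ne_top u) ?_) h
  refine ENNReal.rpow_ne_top_of_nonneg ?_ (by simp)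
  have h1 : (1 : ℝ≥0∞) ≤ p := Fact.out
  -- The Hölder exponent `1 - 1/p` must be nonnegative. For `p = ∞` the conventions `∞.toReal = 0`
  -- and `1 / 0 = 0` make it `1`, as they should.
  rcases eq_or_ne p ∞ with rfl | hp
  · simp
  · have : 1 ≤ p.toReal := by
      simpa using ENNReal.toReal_mono hp h1
    have h2 : 1 / p.toReal ≤ 1 := by
      rw [div_le_one (by linarith)]
      exact this
    simpa using h2

theorem norm_primitive_le {g : ℝ → ℂ} (hg : IntegrableOn g (Ioo a b)) {x : ℝ} (hx : x ∈ Icc a b) :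
    ‖∫ t in a..x, g t‖ ≤ ∫ t in Ioo a b, ‖g t‖ := by
  rw [← integral_Ioc_eq_integral_Ioo]
  refine (intervalIntegral.norm_integral_le_integral_norm hx.1).trans ?_
  rw [intervalIntegral.integral_of_le hx.1]
  refine setIntegral_mono_set ?_ (Eventually.of_forall fun _ => norm_nonneg _)
    (Ioc_subset_Ioc_right hx.2).eventuallyLE
  exact ((integrableOn_Ioc_iff_integrableOn_Ioo).mpr hg).norm

theorem intervalIntegrable_of_Ioo (hab : a < b) {g : ℝ → ℂ} (hg : IntegrableOn g (Ioo a b)) :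
    IntervalIntegrable g volume a b :=
  (intervalIntegrable_iff_integrableOn_Ioo_of_le hab.le).mpr hg

theorem continuousOn_primitive_Icc (hab : a < b) {g : ℝ → ℂ} (hg : IntegrableOn g (Ioo a b)) :
    ContinuousOn (fun x => ∫ t in a..x, g t) (Icc a b) := by
  have := (absolutelyContinuous_primitive hab hg).continuousOn
  rwa [uIcc_of_le hab.le] at this

theorem hasWeakDeriv_primitive (hab : a < b) (c : ℂ) {g : ℝ → ℂ} (hg : IntegrableOn g (Ioo a b)) :
    HasWeakDeriv a b (fun x => c + ∫ t in a..x, g t) g := by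
  refine hasWeakDeriv_of_absolutelyContinuous hab
    ((LipschitzWith.const c).lipschitzOnWith.absolutelyContinuousOnInterval.add
      (absolutelyContinuous_primitive hab hg)) ?_ hg
  filter_upwards [(intervalIntegrable_of_Ioo hab hg).ae_hasDerivAt_integral] with x h2 hx
  exact (h2 hx a left_mem_uIcc).const_add c

/-- Subtracting the primitive of `g` leaves a function with zero weak derivative. The explicit
constant later serves as the boundary value at `a`. -/
theorem HasWeakDeriv.exists_eq_const_add_primitive (hab : a < b) {f g : ℝ → ℂ}
    (hf : IntegrableOn f (Ioo a b)) (hg : IntegrableOn g (Ioo a b)) (h : HasWeakDeriv a b f g) :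
    ∃ c : ℂ, f =ᵐ[volume.restrict (Ioo a b)] fun x => c + ∫ t in a..x, g t := by
  have hPi : IntegrableOn (fun x => (0 : ℂ) + ∫ t in a..x, g t) (Ioo a b) := by
    simp only [zero_add]
    exact ((continuousOn_primitive_Icc hab hg).integrableOn_compact isCompact_Icc).mono_set
      Ioo_subset_Icc_self
  have h0 : HasWeakDeriv a b (fun x => f x + (-1) * (0 + ∫ t in a..x, g t)) 0 := by
    refine (h.add hf hg (hPi.const_mul _) (hg.const_mul _)
      ((hasWeakDeriv_primitive hab 0 hg).const_mul (-1))).congr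
      (EventuallyEq.refl _ _) (Eventually.of_forall fun x => ?_)
    simp
  obtain ⟨c, hc⟩ := h0.ae_const hab (hf.add (hPi.const_mul _))
  refine ⟨c, ?_⟩
  filter_upwards [hc] with x hx
  rw [← hx, Pi.add_apply]
  ring

theorem ae_Ioo_neBot (hab : a < b) : (ae (volume.restrict (Ioo a b))).NeBot := by
  rw [ae_neBot, Ne, Measure.restrict_eq_zero]
  simp [hab]

/-- The interval has positive measure, so the two sides agree at some point. This makes the boundary
value at `a` well defined. -/
theorem const_eq_of_ae_add_eq (hab : a < b) {c c' : ℂ} {f : ℝ → ℂ}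
    (h : (fun x => c + f x) =ᵐ[volume.restrict (Ioo a b)] fun x => c' + f x) : c = c' := by
  have := ae_Ioo_neBot hab
  obtain ⟨x, hx⟩ := h.exists
  exact add_right_cancel hx

/-- In the representation `u = c + ∫ v` the primitive is at most the `L_1` norm of `v`. Integrating
`‖c‖ ≤ ‖u x‖ + K * ‖v‖` over the interval bounds `c`. -/
theorem exists_ae_bound_of_hasWeakDeriv (hab : a < b) (p : ℝ≥0∞) [Fact (1 ≤ p)] :
    ∃ C : ℝ, 0 ≤ C ∧ ∀ u v : LpI a b p, HasWeakDeriv a b u v →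
      ∀ᵐ x ∂(volume.restrict (Ioo a b)), ‖u x‖ ≤ C * (‖u‖ + ‖v‖) := by
  obtain ⟨K, hK0, hK⟩ := LpI.exists_integral_norm_le a b p
  have hba : 0 < b - a := sub_pos.mpr hab
  -- The constant `c` contributes `K / (b - a) * ‖u‖ + K * ‖v‖`, the primitive another `K * ‖v‖`.
  refine ⟨K / (b - a) + 2 * K, by positivity, fun u v h => ?_⟩
  obtain ⟨c, hc⟩ := h.exists_eq_const_add_primitive hab u.integrableOn v.integrableOn
  have hv := hK v
  have hu := hK u
  have hP : ∀ x ∈ Ioo a b, ‖∫ t in a..x, v t‖ ≤ K * ‖v‖ := fun x hx =>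
    (norm_primitive_le v.integrableOn (Ioo_subset_Icc_self hx)).trans hv
  have hcn : (b - a) * ‖c‖ ≤ K * ‖u‖ + (b - a) * (K * ‖v‖) := by
    have h1 : ∫ _x in Ioo a b, ‖c‖ ≤ ∫ x in Ioo a b, (‖u x‖ + K * ‖v‖) := by
      refine integral_mono_ae (integrable_const _) (u.integrableOn.norm.add (integrable_const _)) ?_
      filter_upwards [hc, ae_restrict_mem measurableSet_Ioo] with x hx hx'
      have : c = u x - ∫ t in a..x, v t := by rw [hx]; ring
      calc ‖c‖ ≤ ‖u x‖ + ‖∫ t in a..x, v t‖ := by rw [this]; exact norm_sub_le _ _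
        _ ≤ _ := by gcongr; exact hP x hx'
    rw [integral_add u.integrableOn.norm (integrable_const _)] at h1
    simp only [integral_const, smul_eq_mul, measureReal_restrict_apply_univ,
      Real.volume_real_Ioo_of_le hab.le] at h1
    linarith
  have hc' : ‖c‖ ≤ K / (b - a) * ‖u‖ + K * ‖v‖ := by
    have : ‖c‖ ≤ (K * ‖u‖ + (b - a) * (K * ‖v‖)) / (b - a) := by
      rw [le_div_iff₀ hba]; linarith
    refine this.trans (le_of_eq ?_)
    field_simp
  filter_upwards [hc, ae_restrict_mem measurableSet_Ioo] with x hx hx'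
  have h1 : ‖u x‖ ≤ ‖c‖ + K * ‖v‖ := by
    rw [hx]
    exact (norm_add_le _ _).trans (by gcongr; exact hP x hx')
  have e1 : 0 ≤ K / (b - a) * ‖v‖ := by positivity
  have e2 : 0 ≤ K * ‖u‖ := by positivity
  nlinarith

end Embedding

/-! ### Truncation, multiplication and completeness of Sobolev spaces. -/

section Structure

variable {a b : ℝ} {p : ℝ≥0∞} [Fact (1 ≤ p)] {n : ℕ}

@[simp] theorem Sob.D_add (F G : Sob a b p n) (k : Fin (n + 1)) : (F + G).D k = F.D k + G.D k := rfl

@[simp] theorem Sob.D_smul (c : ℂ) (F : Sob a b p n) (k : Fin (n + 1)) :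
    (c • F).D k = c • F.D k := rfl

@[simp] theorem Sob.D_zero (k : Fin (n + 1)) : (0 : Sob a b p n).D k = 0 := rfl

theorem Sob.D_sub (F G : Sob a b p n) (k : Fin (n + 1)) : (F - G).D k = F.D k - G.D k := rfl

theorem Sob.D_sum {ι : Type*} (s : Finset ι) (F : ι → Sob a b p n) (k : Fin (n + 1)) :
    (∑ i ∈ s, F i).D k = ∑ i ∈ s, (F i).D k := by
  classical
  induction s using Finset.induction_on with
  | empty => simp
  | insert i s hi ih => simp [Finset.sum_insert hi, ih]

theorem Sob.hasWeakDeriv (F : Sob a b p n) (k : ℕ) (h : k < n) :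
    HasWeakDeriv a b (F.D ⟨k, by omega⟩) (F.D ⟨k + 1, by omega⟩) := F.2 ⟨k, h⟩

/-- The derivative of order `k` of a function of class `W_p^n`, as a function of class `W_p^l`,
`k + l ≤ n`. -/
noncomputable def Sob.derivTrunc (k l : ℕ) (h : k + l ≤ n) : Sob a b p n →ₗ[ℂ] Sob a b p l where
  toFun F := ⟨WithLp.toLp 1 fun j : Fin (l + 1) => F.D ⟨k + j, by omega⟩,
    fun j => F.hasWeakDeriv (k + j) (by omega)⟩
  map_add' _ _ := rfl
  map_smul' _ _ := rfl

theorem Sob.derivTrunc_D (k l : ℕ) (h : k + l ≤ n) (F : Sob a b p n) (j : Fin (l + 1)) :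
    (Sob.derivTrunc k l h F).D j = F.D ⟨k + j, by omega⟩ := rfl

theorem Sob.norm_D_le (F : Sob a b p n) (k : Fin (n + 1)) : ‖F.D k‖ ≤ ‖F‖ := by
  rw [F.norm_eq]
  exact Finset.single_le_sum (f := fun k => ‖F.D k‖) (fun _ _ => norm_nonneg _) (Finset.mem_univ k)

theorem Sob.norm_derivTrunc_le (k l : ℕ) (h : k + l ≤ n) (F : Sob a b p n) :
    ‖Sob.derivTrunc k l h F‖ ≤ ‖F‖ := by
  rw [Sob.norm_eq, F.norm_eq]
  simp only [Sob.derivTrunc_D]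
  have hinj : Function.Injective fun j : Fin (l + 1) => (⟨k + j, by omega⟩ : Fin (n + 1)) := by
    intro i j hij
    simp only [Fin.mk.injEq] at hij
    exact Fin.ext (by omega)
  rw [← Finset.sum_image (f := fun k => ‖F.D k‖) (s := Finset.univ) hinj.injOn]
  exact Finset.sum_le_sum_of_subset_of_nonneg (Finset.subset_univ _)
    fun _ _ _ => norm_nonneg _

/-- Prepending a primitive to a function of class `W_p^n`. -/
noncomputable def Sob.cons (u : LpI a b p) (F : Sob a b p n) (h : HasWeakDeriv a b u (F.D 0)) :
    Sob a b p (n + 1) :=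
  ⟨WithLp.toLp 1 (Fin.cons u F.D), by
    intro k
    induction k using Fin.cases with
    | zero => exact h
    | succ k => exact F.2 k⟩

theorem Sob.norm_cons (u : LpI a b p) (F : Sob a b p n) (h : HasWeakDeriv a b u (F.D 0)) :
    ‖Sob.cons u F h‖ = ‖u‖ + ‖F‖ := by
  rw [Sob.norm_eq, F.norm_eq, Fin.sum_univ_succ]
  rfl

omit [Fact (1 ≤ p)] in
theorem LpI.exists_mul {C : ℝ} (u v : LpI a b p)
    (h : ∀ᵐ x ∂(volume.restrict (Ioo a b)), ‖v x‖ ≤ C) :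
    ∃ w : LpI a b p, w =ᵐ[volume.restrict (Ioo a b)] (fun x => u x * v x) ∧ ‖w‖ ≤ C * ‖u‖ := by
  have hm := memLp_mul_of_bound (Lp.memLp u) (Lp.aestronglyMeasurable v) h
  refine ⟨hm.toLp _, hm.coeFn_toLp, ?_⟩
  refine Lp.norm_le_mul_norm_of_ae_le_mul ?_
  filter_upwards [hm.coeFn_toLp, h] with x hx h'
  rw [hx, norm_mul, mul_comm]
  gcongr

/-- Multiplication `W_p^n × W_p^(n+1) → W_p^n` is bounded. -/
theorem Sob.exists_mul (hab : a < b) (p : ℝ≥0∞) [Fact (1 ≤ p)] (n : ℕ) :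
    ∃ C : ℝ, 0 ≤ C ∧ ∀ (F : Sob a b p n) (G : Sob a b p (n + 1)), ∃ H : Sob a b p n,
      H.D 0 =ᵐ[volume.restrict (Ioo a b)] (fun x => F.D 0 x * G.D 0 x) ∧
      ‖H‖ ≤ C * ‖F‖ * ‖G‖ := by
  obtain ⟨K, hK0, hK⟩ := exists_ae_bound_of_hasWeakDeriv hab p
  -- The factor with at least one derivative is essentially bounded, so multiplication by it acts on
  -- `L_p`.
  have bd {l : ℕ} (G : Sob a b p (l + 1)) :
      ∀ᵐ x ∂(volume.restrict (Ioo a b)), ‖G.D 0 x‖ ≤ K * (2 * ‖G‖) := by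
    filter_upwards [hK _ _ (G.hasWeakDeriv 0 (by omega))] with x hx
    refine hx.trans ?_
    have h1 := G.norm_D_le ⟨0, by omega⟩
    have h2 := G.norm_D_le ⟨0 + 1, by omega⟩
    gcongr
    linarith
  have bd' {l k : ℕ} (F : Sob a b p k) (G : Sob a b p (l + 1)) : ∃ w : LpI a b p,
      w =ᵐ[volume.restrict (Ioo a b)] (fun x => F.D 0 x * G.D 0 x) ∧
        ‖w‖ ≤ 2 * K * ‖F‖ * ‖G‖ := by
    obtain ⟨w, hw, hw'⟩ := LpI.exists_mul (F.D 0) (G.D 0) (bd G)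
    refine ⟨w, hw, hw'.trans ?_⟩
    have h1 := F.norm_D_le 0
    calc K * (2 * ‖G‖) * ‖F.D 0‖ ≤ K * (2 * ‖G‖) * ‖F‖ := by gcongr
      _ = _ := by ring
  induction n with
  | zero =>
    refine ⟨2 * K, by positivity, fun F G => ?_⟩
    obtain ⟨w, hw, hw'⟩ := bd' F G
    refine ⟨⟨WithLp.toLp 1 fun _ => w, fun k => k.elim0⟩, hw, ?_⟩
    rw [Sob.norm_eq]
    simpa [Sob.D] using hw'
  | succ n ih =>
    obtain ⟨C, hC0, hC⟩ := ih
    refine ⟨2 * K + 2 * C, by positivity, fun F G => ?_⟩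
    obtain ⟨w, hw, hw'⟩ := bd' F G
    -- The two terms of `(F G)' = F' G + F G'` are again products of a function in `W_p^n` and one
    -- in `W_p^(n+1)`; `derivTrunc 0` only forgets the top derivative.
    obtain ⟨H₁, h1, h1'⟩ := hC (Sob.derivTrunc 1 n (by omega) F)
      (Sob.derivTrunc 0 (n + 1) (by omega) G)
    obtain ⟨H₂, h2, h2'⟩ := hC (Sob.derivTrunc 0 n (by omega) F)
      (Sob.derivTrunc 1 (n + 1) (by omega) G)
    refine ⟨Sob.cons w (H₁ + H₂) ?_, hw, ?_⟩
    · refine (HasWeakDeriv.mul hab (LpI.integrableOn _) (LpI.integrableOn _) (LpI.integrableOn _)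
        (LpI.integrableOn _) (F.hasWeakDeriv 0 (by omega)) (G.hasWeakDeriv 0 (by omega))).congr
        hw.symm ?_
      rw [Sob.D_add]
      filter_upwards [h1, h2, Lp.coeFn_add (H₁.D 0) (H₂.D 0)] with x e1 e2 e3
      rw [e3, Pi.add_apply, e1, e2]
      rfl
    · rw [Sob.norm_cons]
      have n1 := Sob.norm_derivTrunc_le 1 n (by omega) F
      have n2 := Sob.norm_derivTrunc_le 0 n (by omega) F
      have n3 := Sob.norm_derivTrunc_le 0 (n + 1) (by omega) G
      have n4 := Sob.norm_derivTrunc_le 1 (n + 1) (by omega) G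
      have m1 : ‖H₁‖ ≤ C * ‖F‖ * ‖G‖ := h1'.trans (by gcongr)
      have m2 : ‖H₂‖ ≤ C * ‖F‖ * ‖G‖ := h2'.trans (by gcongr)
      have m3 := norm_add_le H₁ H₂
      linarith

theorem LpI.exists_norm_integral_smul_le {φ : ℝ → ℝ} (h1 : Continuous φ)
    (h2 : HasCompactSupport φ) :
    ∃ C : ℝ, ∀ u : LpI a b p, ‖∫ x in Ioo a b, φ x • u x‖ ≤ C * ‖u‖ := by
  obtain ⟨K, hK0, hK⟩ := LpI.exists_integral_norm_le a b p
  obtain ⟨C, hC⟩ := h1.bounded_above_of_compact_support h2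
  have hC0 : 0 ≤ C := (norm_nonneg _).trans (hC 0)
  refine ⟨C * K, fun u => ?_⟩
  calc ‖∫ x in Ioo a b, φ x • u x‖ ≤ ∫ x in Ioo a b, C * ‖u x‖ := by
        refine norm_integral_le_of_norm_le (u.integrableOn.norm.const_mul C)
          (Eventually.of_forall fun x => ?_)
        rw [norm_smul]
        gcongr
        exact hC x
    _ = C * ∫ x in Ioo a b, ‖u x‖ := integral_const_mul _ _
    _ ≤ C * (K * ‖u‖) := by gcongr; exact hK u
    _ = _ := by ring

theorem LpI.continuous_integral_smul {φ : ℝ → ℝ} (h1 : Continuous φ) (h2 : HasCompactSupport φ) :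
    Continuous fun u : LpI a b p => ∫ x in Ioo a b, φ x • u x := by
  obtain ⟨C, hC⟩ := LpI.exists_norm_integral_smul_le (a := a) (b := b) (p := p) h1 h2
  let T : LpI a b p →ₗ[ℂ] ℂ :=
    { toFun := fun u => ∫ x in Ioo a b, φ x • u x
      map_add' := fun u v => by
        rw [← integral_add (integrable_smul_of_test h1 h2 u.integrableOn)
          (integrable_smul_of_test h1 h2 v.integrableOn)]
        refine integral_congr_ae ?_
        filter_upwards [Lp.coeFn_add u v] with x hx
        rw [hx, Pi.add_apply, smul_add]
      map_smul' := fun c u => by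
        rw [RingHom.id_apply, ← integral_smul]
        refine integral_congr_ae ?_
        filter_upwards [Lp.coeFn_smul c u] with x hx
        rw [hx, Pi.smul_apply, smul_comm] }
  exact (T.mkContinuous C hC).continuous

/-- Each test function imposes an equation between functionals that are continuous on `L_p`.
Completeness follows, as needed for Banach–Steinhaus and the open mapping theorem. -/
theorem isClosed_sobolev :
    IsClosed (sobolev a b p n : Set (PiLp 1 fun _ : Fin (n + 1) => LpI a b p)) := by
  have : (sobolev a b p n : Set (PiLp 1 fun _ : Fin (n + 1) => LpI a b p)) =
      ⋂ (k : Fin n) (φ : ℝ → ℝ) (_ : ContDiff ℝ ∞ φ) (_ : HasCompactSupport φ)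
        (_ : tsupport φ ⊆ Ioo a b), {F | ∫ x in Ioo a b, deriv φ x • F k.castSucc x =
          - ∫ x in Ioo a b, φ x • F k.succ x} := by
    ext F
    simp only [mem_iInter, mem_ofPred_eq]
    rfl
  rw [this]
  refine isClosed_iInter fun k => isClosed_iInter fun φ => isClosed_iInter fun h1 =>
    isClosed_iInter fun h2 => isClosed_iInter fun h3 => isClosed_eq ?_ ?_
  · exact (LpI.continuous_integral_smul (h1.continuous_deriv (by simp)) h2.deriv).comp
      (PiLp.continuous_apply 1 _ _)
  · exact ((LpI.continuous_integral_smul h1.continuous h2).comp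
      (PiLp.continuous_apply 1 _ _)).neg

instance : CompleteSpace (Sob a b p n) := isClosed_sobolev.completeSpace_coe

end Structure

/-! ### The differential operator as a bounded operator depending continuously on its coefficients.
-/

section DiffOp

variable {a b : ℝ} {p : ℝ≥0∞} [Fact (1 ≤ p)] {m n r : ℕ}

omit [Fact (1 ≤ p)] in
theorem coeFn_sum {ι : Type*} (s : Finset ι) (u : ι → LpI a b p) :
    (∑ i ∈ s, u i : LpI a b p) =ᵐ[volume.restrict (Ioo a b)] fun x => ∑ i ∈ s, u i x := by
  classical
  induction s using Finset.induction_on with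
  | empty =>
    filter_upwards [Lp.coeFn_zero ℂ p (volume.restrict (Ioo a b))] with x hx
    simpa using hx
  | insert i s hi ih =>
    rw [Finset.sum_insert hi]
    filter_upwards [Lp.coeFn_add (u i) (∑ i ∈ s, u i), ih] with x h1 h2
    rw [h1, Pi.add_apply, h2, Finset.sum_insert hi]

theorem diffExpr_add (A : Fin r → MSob a b p m n) (y z : VSob a b p m (n + r)) (i : Fin m) :
    diffExpr A (y + z) i =ᵐ[volume.restrict (Ioo a b)]
      fun t => diffExpr A y i t + diffExpr A z i t := by
  have h : ∀ᵐ t ∂(volume.restrict (Ioo a b)), ∀ (l : Fin m) (k : Fin (n + r + 1)),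
      ((y + z) l).D k t = (y l).D k t + (z l).D k t := by
    rw [ae_all_iff]
    intro l
    rw [ae_all_iff]
    intro k
    exact Lp.coeFn_add ((y l).D k) ((z l).D k)
  filter_upwards [h] with t ht
  simp only [diffExpr, ht, mul_add, Finset.sum_add_distrib]
  ring

theorem diffExpr_smul (A : Fin r → MSob a b p m n) (c : ℂ) (y : VSob a b p m (n + r))
    (i : Fin m) :
    diffExpr A (c • y) i =ᵐ[volume.restrict (Ioo a b)] fun t => c * diffExpr A y i t := by
  have h : ∀ᵐ t ∂(volume.restrict (Ioo a b)), ∀ (l : Fin m) (k : Fin (n + r + 1)),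
      ((c • y) l).D k t = c * (y l).D k t := by
    rw [ae_all_iff]
    intro l
    rw [ae_all_iff]
    intro k
    exact Lp.coeFn_smul c ((y l).D k)
  filter_upwards [h] with t ht
  simp only [diffExpr, ht, mul_add, Finset.mul_sum]
  congr 1
  exact Finset.sum_congr rfl fun k _ => Finset.sum_congr rfl fun l _ => by ring

/-- `diffOp` as a linear map. -/
noncomputable def diffOpLin (A : Fin r → MSob a b p m n) :
    VSob a b p m (n + r) →ₗ[ℂ] VSob a b p m n where
  toFun := diffOp A
  map_add' y z := by
    refine ((eq_diffOp_iff A _ _).mpr fun i => ?_).symm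
    refine EventuallyEq.trans ?_ (diffExpr_add A y z i).symm
    filter_upwards [Lp.coeFn_add ((diffOp A y i).D 0) ((diffOp A z i).D 0),
      diffOp_ae_eq A y i, diffOp_ae_eq A z i] with t h1 h2 h3
    rw [PiLp.add_apply, Sob.D_add, h1, Pi.add_apply, h2, h3]
  map_smul' c y := by
    refine ((eq_diffOp_iff A _ _).mpr fun i => ?_).symm
    refine EventuallyEq.trans ?_ (diffExpr_smul A c y i).symm
    filter_upwards [Lp.coeFn_smul c ((diffOp A y i).D 0), diffOp_ae_eq A y i] with t h1 h2
    rw [RingHom.id_apply, PiLp.smul_apply, Sob.D_smul, h1, Pi.smul_apply, h2, smul_eq_mul]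

theorem VSob.norm_eq (y : VSob a b p m n) : ‖y‖ = ∑ i, ‖y i‖ := by
  rw [PiLp.norm_eq_of_nat 1 (by simp)]
  simp

theorem VSob.norm_apply_le (y : VSob a b p m n) (i : Fin m) : ‖y i‖ ≤ ‖y‖ := by
  rw [VSob.norm_eq]
  exact Finset.single_le_sum (f := fun i => ‖y i‖) (fun _ _ => norm_nonneg _) (Finset.mem_univ i)

/-- The operator depends Lipschitz continuously on its coefficients. -/
theorem exists_norm_diffOp_sub_le (hab : a < b) (p : ℝ≥0∞) [Fact (1 ≤ p)] (m n r : ℕ) :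
    ∃ C : ℝ, 0 ≤ C ∧ ∀ (A A' : Fin r → MSob a b p m n) (y : VSob a b p m (n + r)),
      ‖diffOp A y - diffOp A' y‖ ≤ C * (∑ k, mnorm (A k - A' k)) * ‖y‖ := by
  obtain ⟨C, hC0, hC⟩ := Sob.exists_mul hab p n
  refine ⟨C, hC0, fun A A' y => ?_⟩
  choose P hP hP' using hC
  -- The leading terms `y^(r)` cancel. For `k < r` the derivative `y^(k)` lies in `W_p^(n+1)`,
  -- because `k + (n + 1) ≤ n + r`; this is the extra derivative that the product estimate requires.
  have key : ∀ i, (diffOp A y - diffOp A' y) i = ∑ k : Fin r, ∑ l : Fin m,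
      P (A k i l - A' k i l) (Sob.derivTrunc k (n + 1) (by omega) (y l)) := by
    intro i
    refine Sob.ext_of_ae ?_
    have e1 : ∀ᵐ t ∂(volume.restrict (Ioo a b)), ∀ (k : Fin r) (l : Fin m),
        (P (A k i l - A' k i l) (Sob.derivTrunc k (n + 1) (by omega) (y l))).D 0 t =
          ((A k i l).D 0 t - (A' k i l).D 0 t) * (y l).D ⟨k, by omega⟩ t := by
      rw [ae_all_iff]
      intro k
      rw [ae_all_iff]
      intro l
      filter_upwards [hP (A k i l - A' k i l) (Sob.derivTrunc k (n + 1) (by omega) (y l)),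
        Lp.coeFn_sub ((A k i l).D 0) ((A' k i l).D 0)] with t h1 h2
      rw [h1, Sob.D_sub, h2]
      rfl
    simp only [Sob.D_sum]
    have e2 := coeFn_sum Finset.univ fun k : Fin r => ∑ l : Fin m,
      (P (A k i l - A' k i l) (Sob.derivTrunc k (n + 1) (by omega) (y l))).D 0
    have e3 : ∀ᵐ t ∂(volume.restrict (Ioo a b)), ∀ k : Fin r,
        (∑ l : Fin m, (P (A k i l - A' k i l) (Sob.derivTrunc k (n + 1) (by omega) (y l))).D 0 :
          LpI a b p) t = ∑ l : Fin m,
            (P (A k i l - A' k i l) (Sob.derivTrunc k (n + 1) (by omega) (y l))).D 0 t := by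
      rw [ae_all_iff]
      intro k
      exact coeFn_sum Finset.univ fun l : Fin m =>
        (P (A k i l - A' k i l) (Sob.derivTrunc k (n + 1) (by omega) (y l))).D 0
    filter_upwards [diffOp_ae_eq A y i, diffOp_ae_eq A' y i, e1, e2, e3,
      Lp.coeFn_sub ((diffOp A y i).D 0) ((diffOp A' y i).D 0)] with t h1 h2 h3 h4 h5 h6
    rw [h4, PiLp.sub_apply, Sob.D_sub, h6, Pi.sub_apply, h1, h2]
    simp only [h5, h3, diffExpr, sub_mul, Finset.sum_sub_distrib]
    ring
  rw [VSob.norm_eq]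
  simp only [key]
  calc ∑ i, ‖∑ k : Fin r, ∑ l : Fin m,
        P (A k i l - A' k i l) (Sob.derivTrunc k (n + 1) (by omega) (y l))‖
      ≤ ∑ i, ∑ k : Fin r, ∑ l : Fin m, C * ‖(A k - A' k) i l‖ * ‖y‖ := by
        refine Finset.sum_le_sum fun i _ => norm_sum_le_of_le _ fun k _ =>
          norm_sum_le_of_le _ fun l _ => (hP' _ _).trans ?_
        have h1 := (Sob.norm_derivTrunc_le k (n + 1) (by omega) (y l)).trans
          (VSob.norm_apply_le y l)
        have h2 : A k i l - A' k i l = (A k - A' k) i l := rfl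
        rw [h2]
        gcongr
    _ = C * (∑ k, mnorm (A k - A' k)) * ‖y‖ := by
        rw [Finset.sum_comm]
        simp only [mnorm, Finset.mul_sum, Finset.sum_mul]

/-- With zero coefficients only `y^(r)` remains. Comparison with this operator turns the Lipschitz
estimate into boundedness for arbitrary coefficients. -/
theorem norm_diffOp_zero_le (y : VSob a b p m (n + r)) :
    ‖diffOp (0 : Fin r → MSob a b p m n) y‖ ≤ ‖y‖ := by
  have key : ∀ i, diffOp (0 : Fin r → MSob a b p m n) y i =
      Sob.derivTrunc r n (by omega) (y i) := by
    intro i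
    refine Sob.ext_of_ae ?_
    have hz : ((0 : LpI a b p) : ℝ → ℂ) =ᵐ[volume.restrict (Ioo a b)] 0 := Lp.coeFn_zero _ _ _
    filter_upwards [diffOp_ae_eq (0 : Fin r → MSob a b p m n) y i, hz] with t h1 h2
    rw [h1]
    simp only [diffExpr, Pi.zero_apply, Matrix.zero_apply, Sob.D_zero, h2, zero_mul,
      Finset.sum_const_zero, add_zero]
    rfl
  rw [VSob.norm_eq, VSob.norm_eq]
  simp only [key]
  exact Finset.sum_le_sum fun i _ => Sob.norm_derivTrunc_le r n (by omega) (y i)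

theorem exists_norm_diffOp_le (hab : a < b) (A : Fin r → MSob a b p m n) :
    ∃ C : ℝ, ∀ y : VSob a b p m (n + r), ‖diffOpLin A y‖ ≤ C * ‖y‖ := by
  obtain ⟨C, hC0, hC⟩ := exists_norm_diffOp_sub_le hab p m n r
  refine ⟨C * (∑ k, mnorm (A k - 0)) + 1, fun y => ?_⟩
  have h1 := hC A 0 y
  have h2 := norm_diffOp_zero_le y
  have h3 := norm_le_norm_sub_add (diffOp A y) (diffOp 0 y)
  change ‖diffOp A y‖ ≤ _
  simp only [Pi.zero_apply] at h1
  linarith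

/-- `diffOp` as a bounded operator. -/
noncomputable def diffOpCLM (hab : a < b) (A : Fin r → MSob a b p m n) :
    VSob a b p m (n + r) →L[ℂ] VSob a b p m n :=
  (diffOpLin A).mkContinuousOfExistsBound (exists_norm_diffOp_le hab A)

end DiffOp

/-! ### Carathéodory's theorem for integral equations with an integrable Lipschitz bound. -/

section Caratheodory

variable {a b : ℝ}

theorem intervalIntegrable_mul_exp {κ : ℝ → ℝ} (hab : a < b)
    (hκ : IntervalIntegrable κ volume a b) {t : ℝ} (ht : t ∈ Icc a b) :
    IntervalIntegrable (fun s => κ s * Real.exp (2 * ∫ u in a..s, κ u)) volume a t := by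
  have hs : uIcc a t ⊆ uIcc a b := uIcc_subset_uIcc_left (by rwa [uIcc_of_le hab.le])
  refine (hκ.mono_set hs).mul_continuousOn ?_
  refine ((continuousOn_const.mul ?_).rexp).mono hs
  exact (hκ.absolutelyContinuousOnInterval_intervalIntegral left_mem_uIcc).continuousOn

/-- The integrand is almost everywhere the derivative of the monotone function `exp (2 ∫ κ) / 2`.
The integral of the derivative of a monotone function is at most its increment, so absolute
continuity of this function is not needed. -/
theorem integral_mul_exp_le {κ : ℝ → ℝ} (hab : a < b) (hκ : IntervalIntegrable κ volume a b)
    (hκ0 : ∀ t, 0 ≤ κ t) {t : ℝ} (ht : t ∈ Icc a b) :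
    ∫ s in a..t, κ s * Real.exp (2 * ∫ u in a..s, κ u) ≤
      Real.exp (2 * ∫ u in a..t, κ u) / 2 := by
  have hs : uIcc a t ⊆ uIcc a b := uIcc_subset_uIcc_left (by rwa [uIcc_of_le hab.le])
  have hκt := hκ.mono_set hs
  set h : ℝ → ℝ := fun s => Real.exp (2 * ∫ u in a..s, κ u) / 2 with hh
  have hmono : MonotoneOn h (uIcc a t) := by
    intro x hx y hy hxy
    have i1 : IntervalIntegrable κ volume a x := hκt.mono_set (uIcc_subset_uIcc_left hx)
    have i2 : IntervalIntegrable κ volume a y := hκt.mono_set (uIcc_subset_uIcc_left hy)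
    have h1 : 0 ≤ (∫ u in a..y, κ u) - ∫ u in a..x, κ u := by
      rw [intervalIntegral.integral_interval_sub_left i2 i1]
      exact intervalIntegral.integral_nonneg hxy fun u _ => hκ0 u
    simp only [hh]
    gcongr
    linarith
  have hd : ∫ s in a..t, κ s * Real.exp (2 * ∫ u in a..s, κ u) = ∫ s in a..t, deriv h s := by
    refine intervalIntegral.integral_congr_ae ?_
    filter_upwards [hκt.ae_hasDerivAt_integral] with x hx hx'
    have h1 := hx (uIoc_subset_uIcc hx') a left_mem_uIcc
    rw [(((h1.const_mul 2).exp).div_const 2).deriv]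
    ring
  have h2 := hmono.intervalIntegral_deriv_mem_uIcc
  rw [uIcc_of_le (sub_nonneg.mpr (hmono left_mem_uIcc right_mem_uIcc ht.1))] at h2
  rw [hd]
  refine h2.2.trans ?_
  have : 0 ≤ h a := by positivity
  change h t - h a ≤ h t
  linarith

variable {E : Type*} [NormedAddCommGroup E] [NormedSpace ℝ E]

theorem continuous_primitive_domRestrict (hab : a < b) {f : ℝ → E}
    (hf : IntervalIntegrable f volume a b) : Continuous fun t : Icc a b => ∫ s in a..t, f s := by
  rw [intervalIntegrable_iff_integrableOn_Icc_of_le hab.le, ← uIcc_of_le hab.le] at hf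
  have h1 := intervalIntegral.continuousOn_primitive_interval hf
  rwa [uIcc_of_le hab.le, continuousOn_iff_continuous_domRestrict] at h1

/-- The weighted Picard operator of the integral equation `X t = x₀ + ∫ s in a..t, N s (X s)` has
exactly one fixed point. -/
theorem existsUnique_fixedPoint_picard [CompleteSpace E] (hab : a < b) {N : ℝ → E → E} {κ : ℝ → ℝ}
    (hκ : IntervalIntegrable κ volume a b) (hκ0 : ∀ t, 0 ≤ κ t)
    (hN : ∀ t x y, ‖N t x - N t y‖ ≤ κ t * ‖x - y‖)
    (hi : ∀ X : ℝ → E, Continuous X → IntervalIntegrable (fun t => N t (X t)) volume a b)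
    (x₀ : E) :
    ∃! U : C(Icc a b, E), ∀ t : Icc a b, Real.exp (2 * ∫ u in a..t, κ u) • U t =
      x₀ + ∫ s in a..t, N s (IccExtend hab.le
        (fun τ : Icc a b => Real.exp (2 * ∫ u in a..τ, κ u) • U τ) s) := by
  -- Bielecki's weight: for `X = w • U`, the sup norm of `U` is a weighted norm of `X` in which the
  -- Picard operator contracts on the whole of `[a, b]`, however large `∫ κ` is.
  set w : ℝ → ℝ := fun t => Real.exp (2 * ∫ u in a..t, κ u) with hw
  have hw0 : ∀ t, 0 < w t := fun t => Real.exp_pos _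
  have hwc : Continuous fun t : Icc a b => w t := by
    have h1 := continuous_primitive_domRestrict hab hκ
    exact (continuous_const.mul h1).rexp
  have hX : ∀ U : C(Icc a b, E), Continuous (IccExtend hab.le fun τ : Icc a b => w τ • U τ) :=
    fun U => (hwc.smul U.continuous).Icc_extend'
  have hprim : ∀ U : C(Icc a b, E), Continuous fun t : Icc a b =>
      ∫ s in a..t, N s (IccExtend hab.le (fun τ : Icc a b => w τ • U τ) s) :=
    fun U => continuous_primitive_domRestrict hab (hi _ (hX U))
  let Φ : C(Icc a b, E) → C(Icc a b, E) := fun U =>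
    ⟨fun t => (w t)⁻¹ • (x₀ + ∫ s in a..t, N s (IccExtend hab.le
      (fun τ : Icc a b => w τ • U τ) s)),
      (hwc.inv₀ fun t => (hw0 t).ne').smul (continuous_const.add (hprim U))⟩
  have hfix : ∀ U : C(Icc a b, E), Function.IsFixedPt Φ U ↔
      ∀ t : Icc a b, w t • U t = x₀ + ∫ s in a..t, N s (IccExtend hab.le
        (fun τ : Icc a b => w τ • U τ) s) := by
    intro U
    rw [Function.IsFixedPt, ContinuousMap.ext_iff]
    refine forall_congr' fun t => ?_
    change (w t)⁻¹ • (_ : E) = U t ↔ _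
    rw [inv_smul_eq_iff₀ (hw0 t).ne', eq_comm]
  -- The factor is `(w t)⁻¹ * ∫ s in a..t, κ s * w s`, which is at most `1 / 2` by
  -- `integral_mul_exp_le`.
  have hcontr : ContractingWith (1 / 2) Φ := by
    refine ⟨by norm_num, LipschitzWith.of_dist_le_mul fun U V => ?_⟩
    rw [ContinuousMap.dist_le (by positivity)]
    intro t
    have hsub : uIcc a (t : ℝ) ⊆ uIcc a b :=
      uIcc_subset_uIcc_left (by rw [uIcc_of_le hab.le]; exact t.2)
    have i1 := (hi _ (hX U)).mono_set hsub
    have i2 := (hi _ (hX V)).mono_set hsub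
    have e1 : Φ U t - Φ V t = (w t)⁻¹ • ∫ s in a..t,
        (N s (IccExtend hab.le (fun τ : Icc a b => w τ • U τ) s) -
          N s (IccExtend hab.le (fun τ : Icc a b => w τ • V τ) s)) := by
      rw [intervalIntegral.integral_sub i1 i2]
      change (w t)⁻¹ • (x₀ + _) - (w t)⁻¹ • (x₀ + _) = _
      rw [← smul_sub, add_sub_add_left_eq_sub]
    have hbd : ‖∫ s in a..t,
        (N s (IccExtend hab.le (fun τ : Icc a b => w τ • U τ) s) -
          N s (IccExtend hab.le (fun τ : Icc a b => w τ • V τ) s))‖ ≤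
        ∫ s in a..t, κ s * w s * dist U V := by
      refine intervalIntegral.norm_integral_le_of_norm_le t.2.1 ?_
        ((intervalIntegrable_mul_exp hab hκ t.2).mul_const _)
      refine Eventually.of_forall fun s hs => (hN _ _ _).trans ?_
      have hs' : s ∈ Icc a b := ⟨hs.1.le, hs.2.trans t.2.2⟩
      rw [IccExtend_of_mem _ _ hs', IccExtend_of_mem _ _ hs', ← smul_sub, norm_smul,
        Real.norm_of_nonneg (hw0 _).le, mul_assoc, ← dist_eq_norm]
      have := hκ0 s
      have := (hw0 s).le
      gcongr
      exact ContinuousMap.dist_apply_le_dist _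
    rw [intervalIntegral.integral_mul_const] at hbd
    have hle := integral_mul_exp_le hab hκ hκ0 t.2
    rw [dist_eq_norm, e1, norm_smul, norm_inv, Real.norm_of_nonneg (hw0 _).le]
    calc (w t)⁻¹ * _ ≤ (w t)⁻¹ * (w t / 2 * dist U V) := by
          gcongr
          exact hbd.trans (by gcongr)
      _ = _ := by
        have := (hw0 t).ne'
        push_cast
        field_simp
  refine ⟨ContractingWith.fixedPoint Φ hcontr, (hfix _).mp hcontr.fixedPoint_isFixedPt,
    fun V hV => hcontr.fixedPoint_unique ((hfix V).mpr hV)⟩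

theorem exists_integral_eq [CompleteSpace E] (hab : a < b) {N : ℝ → E → E} {κ : ℝ → ℝ}
    (hκ : IntervalIntegrable κ volume a b) (hκ0 : ∀ t, 0 ≤ κ t)
    (hN : ∀ t x y, ‖N t x - N t y‖ ≤ κ t * ‖x - y‖)
    (hi : ∀ X : ℝ → E, Continuous X → IntervalIntegrable (fun t => N t (X t)) volume a b)
    (x₀ : E) :
    ∃ X : ℝ → E, Continuous X ∧ ∀ t ∈ Icc a b, X t = x₀ + ∫ s in a..t, N s (X s) := by
  obtain ⟨U, hU, -⟩ := existsUnique_fixedPoint_picard hab hκ hκ0 hN hi x₀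
  refine ⟨IccExtend hab.le (fun τ : Icc a b => Real.exp (2 * ∫ u in a..τ, κ u) • U τ), ?_, ?_⟩
  · have h1 := continuous_primitive_domRestrict hab hκ
    exact (((continuous_const.mul h1).rexp).smul U.continuous).Icc_extend'
  · intro t ht
    rw [IccExtend_of_mem _ _ ht]
    exact hU ⟨t, ht⟩

theorem eqOn_of_integral_eq [CompleteSpace E] (hab : a < b) {N : ℝ → E → E} {κ : ℝ → ℝ}
    (hκ : IntervalIntegrable κ volume a b) (hκ0 : ∀ t, 0 ≤ κ t)
    (hN : ∀ t x y, ‖N t x - N t y‖ ≤ κ t * ‖x - y‖)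
    (hi : ∀ X : ℝ → E, Continuous X → IntervalIntegrable (fun t => N t (X t)) volume a b)
    {x₀ : E} {X Y : ℝ → E} (hXc : ContinuousOn X (Icc a b)) (hYc : ContinuousOn Y (Icc a b))
    (hX : ∀ t ∈ Icc a b, X t = x₀ + ∫ s in a..t, N s (X s))
    (hY : ∀ t ∈ Icc a b, Y t = x₀ + ∫ s in a..t, N s (Y s)) : EqOn X Y (Icc a b) := by
  have h1 := continuous_primitive_domRestrict hab hκ
  have hwc : Continuous fun t : Icc a b => Real.exp (2 * ∫ u in a..t, κ u) :=
    (continuous_const.mul h1).rexp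
  -- Dividing a solution by the weight gives a fixed point of the weighted Picard operator, and that
  -- fixed point is unique.
  let conj (Z : ℝ → E) (hZ : ContinuousOn Z (Icc a b)) : C(Icc a b, E) :=
    ⟨fun t => (Real.exp (2 * ∫ u in a..t, κ u))⁻¹ • Z t,
      (hwc.inv₀ fun _ => (Real.exp_pos _).ne').smul (continuousOn_iff_continuous_domRestrict.mp hZ)⟩
  have hconj (Z : ℝ → E) (hZ : ContinuousOn Z (Icc a b)) (t : Icc a b) :
      Real.exp (2 * ∫ u in a..t, κ u) • conj Z hZ t = Z t :=
    smul_inv_smul₀ (Real.exp_pos _).ne' _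
  have key (Z : ℝ → E) (hZ : ContinuousOn Z (Icc a b))
      (h : ∀ t ∈ Icc a b, Z t = x₀ + ∫ s in a..t, N s (Z s)) (t : Icc a b) :
      Real.exp (2 * ∫ u in a..t, κ u) • conj Z hZ t =
        x₀ + ∫ s in a..t, N s (IccExtend hab.le
          (fun τ : Icc a b => Real.exp (2 * ∫ u in a..τ, κ u) • conj Z hZ τ) s) := by
    rw [hconj Z hZ, h t t.2]
    congr 1
    refine intervalIntegral.integral_congr fun s hs => ?_
    rw [uIcc_of_le t.2.1] at hs
    simp only [hconj Z hZ]
    rw [IccExtend_of_mem _ _ ⟨hs.1, hs.2.trans t.2.2⟩]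
  have e := (existsUnique_fixedPoint_picard hab hκ hκ0 hN hi x₀).unique (key X hXc hX) (key Y hYc hY)
  intro t ht
  rw [← hconj X hXc ⟨t, ht⟩, ← hconj Y hYc ⟨t, ht⟩, e]

end Caratheodory

/-- The algebraic Fredholm alternative: `B` restricted to `ker L` is an injection between spaces of
equal finite dimension, hence a bijection. A particular solution of `L u = f` is then corrected by
the unique kernel element with boundary value `c - B u`. -/
theorem existsUnique_of_ker_trivial {K F G Z : Type*} [Field K] [AddCommGroup F] [Module K F]
    [AddCommGroup G] [Module K G] [AddCommGroup Z] [Module K Z] [FiniteDimensional K Z]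
    (L : F →ₗ[K] G) (B : F →ₗ[K] Z) (hL : Function.Surjective L)
    [FiniteDimensional K (LinearMap.ker L)]
    (hdim : Module.finrank K (LinearMap.ker L) = Module.finrank K Z)
    (h : ∀ y, L y = 0 → B y = 0 → y = 0) (f : G) (c : Z) : ∃! y, L y = f ∧ B y = c := by
  let T : LinearMap.ker L →ₗ[K] Z := B.comp (LinearMap.ker L).subtype
  have hTinj : Function.Injective T := by
    rw [injective_iff_map_eq_zero]
    intro y hy
    exact Subtype.ext (h y y.2 hy)
  have hTsurj : Function.Surjective T :=
    (LinearMap.injective_iff_surjective_of_finrank_eq_finrank hdim).mp hTinj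
  obtain ⟨u, hu⟩ := hL f
  obtain ⟨z, hz⟩ := hTsurj (c - B u)
  have hz1 : L z = 0 := z.2
  have hz2 : B z = c - B u := hz
  refine ⟨u + z, ⟨by rw [map_add, hz1, hu, add_zero], by rw [map_add, hz2]; abel⟩, ?_⟩
  rintro y ⟨hy1, hy2⟩
  refine sub_eq_zero.mp (h _ ?_ ?_)
  · rw [map_sub, map_add, hz1, hu, hy1]
    abel
  · rw [map_sub, map_add, hz2, hy2]
    abel

/-! ### The Cauchy problem and unique solvability of the boundary-value problem. -/

section Cauchy

variable {a b : ℝ} {p : ℝ≥0∞} [Fact (1 ≤ p)] {m n r : ℕ}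

theorem primitive_congr {f g : ℝ → ℂ} (h : f =ᵐ[volume.restrict (Ioo a b)] g) {x : ℝ}
    (hx : x ∈ Icc a b) : ∫ t in a..x, f t = ∫ t in a..x, g t := by
  rw [restrict_Ioo_eq_restrict_Ioc] at h
  rw [intervalIntegral.integral_of_le hx.1, intervalIntegral.integral_of_le hx.1]
  exact integral_congr_ae (ae_restrict_of_ae_restrict_of_subset (Ioc_subset_Ioc_right hx.2) h)

theorem Sob.exists_trace (hab : a < b) (F : Sob a b p n) (k : ℕ) (hk : k < n) :
    ∃ c : ℂ, F.D ⟨k, by omega⟩ =ᵐ[volume.restrict (Ioo a b)]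
      fun x => c + ∫ t in a..x, F.D ⟨k + 1, by omega⟩ t :=
  (F.hasWeakDeriv k hk).exists_eq_const_add_primitive hab (LpI.integrableOn _)
    (LpI.integrableOn _)

/-- The value at `a` of the derivative of order `k < n` of a function of class `W_p^n`. -/
noncomputable def Sob.trace (hab : a < b) (F : Sob a b p n) (k : ℕ) (hk : k < n) : ℂ :=
  Classical.choose (F.exists_trace hab k hk)

theorem Sob.trace_spec (hab : a < b) (F : Sob a b p n) (k : ℕ) (hk : k < n) :
    F.D ⟨k, by omega⟩ =ᵐ[volume.restrict (Ioo a b)]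
      fun x => F.trace hab k hk + ∫ t in a..x, F.D ⟨k + 1, by omega⟩ t :=
  Classical.choose_spec (F.exists_trace hab k hk)

theorem Sob.trace_eq (hab : a < b) (F : Sob a b p n) (k : ℕ) (hk : k < n) {c : ℂ}
    (h : F.D ⟨k, by omega⟩ =ᵐ[volume.restrict (Ioo a b)]
      fun x => c + ∫ t in a..x, F.D ⟨k + 1, by omega⟩ t) : F.trace hab k hk = c :=
  const_eq_of_ae_add_eq hab ((F.trace_spec hab k hk).symm.trans h)

theorem Sob.trace_add (hab : a < b) (F G : Sob a b p n) (k : ℕ) (hk : k < n) :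
    (F + G).trace hab k hk = F.trace hab k hk + G.trace hab k hk := by
  refine Sob.trace_eq hab _ k hk ?_
  simp only [Sob.D_add]
  filter_upwards [F.trace_spec hab k hk, G.trace_spec hab k hk, Lp.coeFn_add (F.D ⟨k, by omega⟩)
    (G.D ⟨k, by omega⟩), ae_restrict_mem measurableSet_Ioo] with x h1 h2 h3 hx
  have hs : uIcc a x ⊆ uIcc a b := uIcc_subset_uIcc_left (by
    rw [uIcc_of_le hab.le]; exact Ioo_subset_Icc_self hx)
  rw [h3, Pi.add_apply, h1, h2, primitive_congr (Lp.coeFn_add _ _) (Ioo_subset_Icc_self hx)]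
  simp only [Pi.add_apply]
  rw [intervalIntegral.integral_add
    ((intervalIntegrable_of_Ioo hab (LpI.integrableOn _)).mono_set hs)
    ((intervalIntegrable_of_Ioo hab (LpI.integrableOn _)).mono_set hs)]
  ring

theorem Sob.trace_smul (hab : a < b) (c : ℂ) (F : Sob a b p n) (k : ℕ) (hk : k < n) :
    (c • F).trace hab k hk = c * F.trace hab k hk := by
  refine Sob.trace_eq hab _ k hk ?_
  simp only [Sob.D_smul]
  filter_upwards [F.trace_spec hab k hk, Lp.coeFn_smul c (F.D ⟨k, by omega⟩),
    ae_restrict_mem measurableSet_Ioo] with x h1 h2 hx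
  rw [h2, Pi.smul_apply, h1, primitive_congr (Lp.coeFn_smul _ _) (Ioo_subset_Icc_self hx)]
  simp only [Pi.smul_apply, smul_eq_mul]
  rw [intervalIntegral.integral_const_mul]
  ring

/-- The Cauchy data at `a` of a vector function of class `W_p^(n+r)`. -/
noncomputable def cauchyData (hab : a < b) :
    VSob a b p m (n + r) →ₗ[ℂ] (Fin r × Fin m → ℂ) where
  toFun y q := (y q.2).trace hab q.1 (by omega)
  map_add' y z := funext fun q => Sob.trace_add hab _ _ _ _
  map_smul' c y := funext fun q => Sob.trace_smul hab _ _ _ _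

/-- The right-hand side of the first-order system for `(y, y', …, y^(r-1))` equivalent to
`L y = f`. -/
noncomputable def firstOrderField (A : Fin r → MSob a b p m n) (f : Fin m → ℝ → ℂ) (t : ℝ)
    (x : Fin r × Fin m → ℂ) (q : Fin r × Fin m) : ℂ :=
  if h : q.1.1 + 1 < r then x (⟨q.1 + 1, h⟩, q.2)
  else f q.2 t + (-1) * ∑ k, ∑ l, (A k q.2 l).D 0 t * x (k, l)

theorem firstOrderField_of_lt (A : Fin r → MSob a b p m n) (f : Fin m → ℝ → ℂ) (t : ℝ)
    (x : Fin r × Fin m → ℂ) (k : ℕ) (h : k + 1 < r) (l : Fin m) :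
    firstOrderField A f t x (⟨k, by omega⟩, l) = x (⟨k + 1, h⟩, l) := dif_pos h

theorem firstOrderField_of_eq (A : Fin r → MSob a b p m n) (f : Fin m → ℝ → ℂ) (t : ℝ)
    (x : Fin r × Fin m → ℂ) (k : ℕ) (h : k + 1 = r) (l : Fin m) :
    firstOrderField A f t x (⟨k, by omega⟩, l) =
      f l t + (-1) * ∑ k, ∑ j, (A k l j).D 0 t * x (k, j) := dif_neg (by simp; omega)

/-- A Lipschitz bound for `firstOrderField`. -/
noncomputable def coeffBound (A : Fin r → MSob a b p m n) (t : ℝ) : ℝ :=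
  1 + ∑ i, ∑ k, ∑ l, ‖(A k i l).D 0 t‖

theorem coeffBound_nonneg (A : Fin r → MSob a b p m n) (t : ℝ) : 0 ≤ coeffBound A t := by
  unfold coeffBound
  positivity

theorem intervalIntegrable_coeffBound (hab : a < b) (A : Fin r → MSob a b p m n) :
    IntervalIntegrable (coeffBound A) volume a b := by
  rw [intervalIntegrable_iff_integrableOn_Ioo_of_le hab.le]
  exact (integrable_const _).add (integrable_finsetSum _ fun i _ =>
    integrable_finsetSum _ fun k _ => integrable_finsetSum _ fun l _ =>
      (LpI.integrableOn _).norm)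

/-- The rows that shift to the next derivative are 1-Lipschitz in the sup norm, which explains the
`1` in `coeffBound`; the last row is bounded by the coefficient sum. -/
theorem norm_firstOrderField_sub_le (A : Fin r → MSob a b p m n) (f : Fin m → ℝ → ℂ) (t : ℝ)
    (x y : Fin r × Fin m → ℂ) :
    ‖firstOrderField A f t x - firstOrderField A f t y‖ ≤ coeffBound A t * ‖x - y‖ := by
  have h0 := coeffBound_nonneg A t
  rw [pi_norm_le_iff_of_nonneg (by positivity)]
  have hS : 0 ≤ ∑ i, ∑ k, ∑ l, ‖(A k i l).D 0 t‖ := by positivity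
  rintro ⟨q, i⟩
  rw [Pi.sub_apply]
  by_cases h : q.1 + 1 < r
  · rw [firstOrderField_of_lt A f t x q h i, firstOrderField_of_lt A f t y q h i]
    refine (norm_le_pi_norm (x - y) (⟨q + 1, h⟩, i)).trans ?_
    refine le_mul_of_one_le_left (norm_nonneg _) ?_
    unfold coeffBound
    linarith
  · have h' : q.1 + 1 = r := by omega
    rw [firstOrderField_of_eq A f t x q h' i, firstOrderField_of_eq A f t y q h' i]
    have e : f i t + (-1) * ∑ k, ∑ j, (A k i j).D 0 t * x (k, j) -
        (f i t + (-1) * ∑ k, ∑ j, (A k i j).D 0 t * y (k, j)) =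
        - ∑ k, ∑ j, (A k i j).D 0 t * (x - y) (k, j) := by
      simp only [Pi.sub_apply, mul_sub, Finset.sum_sub_distrib]
      ring
    rw [e, norm_neg]
    calc ‖∑ k, ∑ j, (A k i j).D 0 t * (x - y) (k, j)‖
        ≤ ∑ k, ∑ j, ‖(A k i j).D 0 t‖ * ‖x - y‖ :=
          norm_sum_le_of_le _ fun k _ => norm_sum_le_of_le _ fun j _ => by
            rw [norm_mul]
            gcongr
            exact norm_le_pi_norm (x - y) (k, j)
      _ = (∑ k, ∑ j, ‖(A k i j).D 0 t‖) * ‖x - y‖ := by simp only [Finset.sum_mul]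
      _ ≤ _ := by
        gcongr
        have := Finset.single_le_sum (f := fun i => ∑ k, ∑ j, ‖(A k i j).D 0 t‖)
          (fun _ _ => by positivity) (Finset.mem_univ i)
        unfold coeffBound
        linarith

theorem integrableOn_mul_of_continuousOn {f g : ℝ → ℂ} (hf : IntegrableOn f (Ioo a b))
    (hg : ContinuousOn g (Icc a b)) : IntegrableOn (fun t => f t * g t) (Ioo a b) := by
  obtain ⟨C, hC⟩ := isCompact_Icc.exists_bound_of_continuousOn hg
  refine Integrable.mul_bdd (c := C) hf
    ((hg.mono Ioo_subset_Icc_self).aestronglyMeasurable measurableSet_Ioo) ?_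
  filter_upwards [ae_restrict_mem measurableSet_Ioo] with x hx
  exact hC x (Ioo_subset_Icc_self hx)

theorem integrableOn_firstOrderField (A : Fin r → MSob a b p m n) {f : Fin m → ℝ → ℂ}
    (hf : ∀ i, IntegrableOn (f i) (Ioo a b)) {X : ℝ → Fin r × Fin m → ℂ}
    (hX : ContinuousOn X (Icc a b)) (q : Fin r × Fin m) :
    IntegrableOn (fun t => firstOrderField A f t (X t) q) (Ioo a b) := by
  have hXq := continuousOn_pi.mp hX
  obtain ⟨k, i⟩ := q
  by_cases h : k.1 + 1 < r
  · simp only [firstOrderField_of_lt A f _ _ k h i]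
    exact ((hXq _).integrableOn_compact isCompact_Icc).mono_set Ioo_subset_Icc_self
  · simp only [firstOrderField_of_eq A f _ _ k (show k.1 + 1 = r by omega) i]
    exact (hf i).add (Integrable.const_mul (integrable_finsetSum _ fun k _ =>
      integrable_finsetSum _ fun j _ =>
        integrableOn_mul_of_continuousOn (LpI.integrableOn _) (hXq (k, j))) _)

theorem intervalIntegrable_firstOrderField (hab : a < b) (A : Fin r → MSob a b p m n)
    {f : Fin m → ℝ → ℂ} (hf : ∀ i, IntegrableOn (f i) (Ioo a b)) {X : ℝ → Fin r × Fin m → ℂ}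
    (hX : ContinuousOn X (Icc a b)) :
    IntervalIntegrable (fun t => firstOrderField A f t (X t)) volume a b := by
  rw [intervalIntegrable_iff_integrableOn_Ioo_of_le hab.le]
  exact Integrable.of_eval fun q => integrableOn_firstOrderField A hf hX q

theorem integral_firstOrderField_apply (hab : a < b) (A : Fin r → MSob a b p m n)
    {f : Fin m → ℝ → ℂ} (hf : ∀ i, IntegrableOn (f i) (Ioo a b)) {X : ℝ → Fin r × Fin m → ℂ}
    (hX : ContinuousOn X (Icc a b)) {t : ℝ} (ht : t ∈ Icc a b) (q : Fin r × Fin m) :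
    (∫ s in a..t, firstOrderField A f s (X s)) q = ∫ s in a..t, firstOrderField A f s (X s) q := by
  have hs : uIcc a t ⊆ uIcc a b := uIcc_subset_uIcc_left (by rwa [uIcc_of_le hab.le])
  exact (ContinuousLinearMap.intervalIntegral_comp_comm
    (ContinuousLinearMap.proj (R := ℂ) (φ := fun _ : Fin r × Fin m => ℂ) q)
    ((intervalIntegrable_firstOrderField hab A hf hX).mono_set hs)).symm

omit [Fact (1 ≤ p)] in
theorem IsSob.const_mul (c : ℂ) {f : ℝ → ℂ} : ∀ {n : ℕ}, IsSob a b p n f →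
    IsSob a b p n (fun x => c * f x) := by
  intro n
  induction n generalizing f with
  | zero => exact fun h => MemLp.const_mul h c
  | succ n ih =>
    rintro ⟨h, g, hg, hg'⟩
    exact ⟨h.const_mul c, _, hg.const_mul c, ih hg'⟩

/-- `W_p^(n+1)` is closed under multiplication. -/
theorem IsSob.mul_self (hab : a < b) {f g : ℝ → ℂ} (hf : IsSob a b p (n + 1) f)
    (hg : IsSob a b p (n + 1) g) : IsSob a b p (n + 1) (fun x => f x * g x) := by
  have h0 : IsSob a b p 0 (fun x => f x * g x) :=
    IsSob.mul hab (hf.of_le (Nat.zero_le _)) (hg.of_le (by omega))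
  obtain ⟨f1, f', hf', hf''⟩ := id hf
  obtain ⟨g1, g', hg', hg''⟩ := id hg
  refine ⟨h0, _, hf'.mul hab hf.integrableOn hf''.integrableOn hg.integrableOn
    hg''.integrableOn hg', (hf''.mul hab hg).add ?_⟩
  simp only [mul_comm (f _)]
  exact hg''.mul hab hf

omit [Fact (1 ≤ p)] in
theorem memLp_of_continuousOn {f : ℝ → ℂ} (hf : ContinuousOn f (Icc a b)) :
    MemLp f p (volume.restrict (Ioo a b)) := by
  obtain ⟨C, hC⟩ := isCompact_Icc.exists_bound_of_continuousOn hf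
  refine MemLp.of_bound
    ((hf.mono Ioo_subset_Icc_self).aestronglyMeasurable measurableSet_Ioo) C ?_
  filter_upwards [ae_restrict_mem measurableSet_Ioo] with x hx
  exact hC x (Ioo_subset_Icc_self hx)

/-- The components of a solution of the first-order system are Sobolev functions. -/
theorem isSob_of_integral_eq (hab : a < b) (A : Fin r → MSob a b p m n)
    (f : Fin m → Sob a b p n) {X : ℝ → Fin r × Fin m → ℂ} (hX : ContinuousOn X (Icc a b))
    (hw : ∀ q, HasWeakDeriv a b (fun t => X t q)
      (fun t => firstOrderField A (fun i => (f i).D 0) t (X t) q)) :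
    ∀ i, ∀ hi : i < r, ∀ l, IsSob a b p (n + 1 + i) (fun t => X t (⟨r - 1 - i, by omega⟩, l)) := by
  have hXq := continuousOn_pi.mp hX
  set G : Fin m → ℝ → ℂ := fun i t =>
    (f i).D 0 t + (-1) * ∑ k, ∑ l, (A k i l).D 0 t * X t (k, l) with hG
  -- If the last row of the field is in `W_p^j`, the component of order `r - 1` is in `W_p^(j+1)`,
  -- and each step down in order gains one more derivative. The index `i` counts down from `r - 1`.
  have step : ∀ j, (∀ l, IsSob a b p j (G l)) → ∀ i, ∀ hi : i < r, ∀ l,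
      IsSob a b p (j + 1 + i) (fun t => X t (⟨r - 1 - i, by omega⟩, l)) := by
    intro j hj i
    induction i with
    | zero =>
      intro hi l
      refine ⟨memLp_of_continuousOn (hXq _), _, hw _, ?_⟩
      have e := fun t => firstOrderField_of_eq A (fun i => (f i).D 0) t (X t) (r - 1 - 0)
        (by omega) l
      simp only [e]
      exact hj l
    | succ i ih =>
      intro hi l
      refine ⟨memLp_of_continuousOn (hXq _), _, hw _, ?_⟩
      have e := fun t => firstOrderField_of_lt A (fun i => (f i).D 0) t (X t) (r - 1 - (i + 1))
        (by omega) l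
      simp only [e]
      have h1 := ih (by omega) l
      have e2 : r - 1 - (i + 1) + 1 = r - 1 - i := by omega
      simp only [e2]
      exact h1
  -- Bootstrap: regularity `j` of the last row puts every component in `W_p^(j+1)`, an algebra,
  -- which returns regularity `j + 1` as long as the data and coefficients allow it. The start uses
  -- only that `X` is bounded.
  have reg : ∀ j ≤ n, ∀ l, IsSob a b p j (G l) := by
    intro j
    induction j with
    | zero =>
      intro _ l
      refine IsSob.add (Lp.memLp _) (IsSob.const_mul _ (IsSob.sum _ fun k _ =>
        IsSob.sum _ fun i _ => ?_))
      obtain ⟨C, hC⟩ := isCompact_Icc.exists_bound_of_continuousOn (hXq (k, i))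
      refine memLp_mul_of_bound (C := C) (Lp.memLp _)
        (memLp_of_continuousOn (p := p) (hXq (k, i))).1 ?_
      filter_upwards [ae_restrict_mem measurableSet_Ioo] with x hx
      exact hC x (Ioo_subset_Icc_self hx)
    | succ j ih =>
      intro hj l
      refine IsSob.add (((f l).isSob_D n 0 (by omega)).of_le hj) (IsSob.const_mul _
        (IsSob.sum _ fun k _ => IsSob.sum _ fun i _ => IsSob.mul_self hab
          (((A k l i).isSob_D n 0 (by omega)).of_le hj) ?_))
      have h1 := (step j (ih (by omega)) (r - 1 - k) (by omega) i).of_le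
        (show j + 1 ≤ j + 1 + (r - 1 - k) by omega)
      have e2 : r - 1 - (r - 1 - k.1) = k := by omega
      simp only [e2] at h1
      exact h1
  exact step n (reg n le_rfl)

theorem exists_diffOp_eq_and_cauchyData_eq (hab : a < b) (hr : 1 ≤ r) (A : Fin r → MSob a b p m n)
    (f : VSob a b p m n) (x₀ : Fin r × Fin m → ℂ) :
    ∃ y : VSob a b p m (n + r), diffOp A y = f ∧ cauchyData hab y = x₀ := by
  set N := firstOrderField A fun i => (f i).D 0 with hN
  have hf : ∀ i, IntegrableOn ((f i).D 0) (Ioo a b) := fun i => LpI.integrableOn _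
  obtain ⟨X, hXc, hX⟩ := exists_integral_eq hab (intervalIntegrable_coeffBound hab A)
    (coeffBound_nonneg A) (norm_firstOrderField_sub_le A fun i => (f i).D 0)
    (fun X hX => intervalIntegrable_firstOrderField hab A hf hX.continuousOn) x₀
  have hXq : ∀ q, ∀ t ∈ Icc a b, X t q = x₀ q + ∫ s in a..t, N s (X s) q := by
    intro q t ht
    rw [hX t ht, Pi.add_apply, integral_firstOrderField_apply hab A hf hXc.continuousOn ht q]
  have hNi := integrableOn_firstOrderField A hf (hXc.continuousOn (s := Icc a b))
  have hw : ∀ q, HasWeakDeriv a b (fun t => X t q) (fun t => N t (X t) q) := by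
    intro q
    refine (hasWeakDeriv_primitive hab (x₀ q) (hNi q)).congr ?_ (EventuallyEq.refl _ _)
    filter_upwards [ae_restrict_mem measurableSet_Ioo] with t ht
    exact (hXq q t (Ioo_subset_Icc_self ht)).symm
  have hsob : ∀ l, IsSob a b p (n + r) (fun t => X t (⟨0, by omega⟩, l)) := by
    intro l
    have h1 := isSob_of_integral_eq hab A f hXc.continuousOn hw (r - 1) (by omega) l
    have e1 : n + 1 + (r - 1) = n + r := by omega
    have e2 : r - 1 - (r - 1) = 0 := by omega
    simp only [e1, e2] at h1
    exact h1
  choose y hy using fun l => (hsob l).exists_sob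
  -- If `y^(k)` is the component `k` of `X`, both have the same weak derivative, so the system
  -- determines `y^(k+1)`. For `k = r - 1` this is the equation `L y = f`.
  have next : ∀ (l : Fin m) (k : ℕ) (hk : k < r),
      (y l).D ⟨k, by omega⟩ =ᵐ[volume.restrict (Ioo a b)] (fun t => X t (⟨k, hk⟩, l)) →
      (y l).D ⟨k + 1, by omega⟩ =ᵐ[volume.restrict (Ioo a b)]
        fun t => N t (X t) (⟨k, hk⟩, l) := by
    intro l k hk h
    exact HasWeakDeriv.unique (LpI.integrableOn _) (hNi _)
      (((y l).hasWeakDeriv k (by omega)).congr h (EventuallyEq.refl _ _)) (hw _)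
  have hD : ∀ (l : Fin m) (k : ℕ) (hk : k < r),
      (y l).D ⟨k, by omega⟩ =ᵐ[volume.restrict (Ioo a b)] (fun t => X t (⟨k, hk⟩, l)) := by
    intro l k
    induction k with
    | zero => exact fun hk => hy l
    | succ k ih =>
      intro hk
      have h1 := next l k (by omega) (ih (by omega))
      simp only [hN, firstOrderField_of_lt _ _ _ _ k hk l] at h1
      exact h1
  refine ⟨WithLp.toLp 1 y, ((eq_diffOp_iff A _ f).mpr fun i => ?_).symm, funext fun q => ?_⟩
  · have h1 : (y i).D ⟨r, by omega⟩ =ᵐ[volume.restrict (Ioo a b)]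
        fun t => (f i).D 0 t + (-1) * ∑ k, ∑ j, (A k i j).D 0 t * X t (k, j) := by
      have h2 := next i (r - 1) (by omega) (hD i (r - 1) (by omega))
      have e := fun t => firstOrderField_of_eq A (fun i => (f i).D 0) t (X t) (r - 1)
        (by omega) i
      have e2 : r - 1 + 1 = r := by omega
      simp only [hN, e, e2] at h2
      exact h2
    have h2 : ∀ᵐ t ∂(volume.restrict (Ioo a b)), ∀ (l : Fin m) (k : Fin r),
        (y l).D ⟨k, by omega⟩ t = X t (k, l) := by
      rw [ae_all_iff]
      intro l
      rw [ae_all_iff]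
      exact fun k => hD l k k.2
    filter_upwards [h1, h2] with t e1 e2
    simp only [diffExpr, e1, e2]
    ring
  · obtain ⟨k, l⟩ := q
    refine Sob.trace_eq hab (y l) k (by omega) ?_
    filter_upwards [hD l k k.2, ae_restrict_mem measurableSet_Ioo] with t e1 ht
    rw [e1, hXq _ t (Ioo_subset_Icc_self ht),
      primitive_congr (next l k k.2 (hD l k k.2)) (Ioo_subset_Icc_self ht)]

/-- With vanishing Cauchy data each `y^(k)`, `k < r`, is the primitive from `a` of the next
derivative. These primitives solve the homogeneous integral equation with zero initial value, whose
only continuous solution is zero. -/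
theorem eq_zero_of_diffOp_eq_zero (hab : a < b) (hr : 1 ≤ r) (A : Fin r → MSob a b p m n)
    (y : VSob a b p m (n + r)) (h1 : diffOp A y = 0) (h2 : cauchyData hab y = 0) : y = 0 := by
  set X : ℝ → Fin r × Fin m → ℂ := fun t q => ∫ s in a..t, (y q.2).D ⟨q.1 + 1, by omega⟩ s with hX
  have hXc : ContinuousOn X (Icc a b) := continuousOn_pi.mpr fun q =>
    continuousOn_primitive_Icc hab (LpI.integrableOn _)
  have hD : ∀ (l : Fin m) (k : Fin r),
      (y l).D ⟨k, by omega⟩ =ᵐ[volume.restrict (Ioo a b)] (fun t => X t (k, l)) := by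
    intro l k
    have h3 : (y l).trace hab k (by omega) = 0 := congrFun h2 (k, l)
    have h4 := (y l).trace_spec hab k (by omega)
    simp only [h3, zero_add] at h4
    exact h4
  have hDall : ∀ᵐ t ∂(volume.restrict (Ioo a b)), ∀ (l : Fin m) (k : Fin r),
      (y l).D ⟨k, by omega⟩ t = X t (k, l) := by
    rw [ae_all_iff]
    intro l
    rw [ae_all_iff]
    exact hD l
  have hf : ∀ i : Fin m, IntegrableOn ((fun _ _ => 0 : Fin m → ℝ → ℂ) i) (Ioo a b) :=
    fun i => integrableOn_zero
  have hN : ∀ q : Fin r × Fin m, (y q.2).D ⟨q.1 + 1, by omega⟩ =ᵐ[volume.restrict (Ioo a b)]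
      fun t => firstOrderField A (fun _ _ => 0) t (X t) q := by
    rintro ⟨k, l⟩
    by_cases h : k.1 + 1 < r
    · simp only [firstOrderField_of_lt _ _ _ _ k.1 h l]
      exact hD l ⟨k + 1, h⟩
    · have h' : k.1 + 1 = r := by omega
      have hz : ((0 : LpI a b p) : ℝ → ℂ) =ᵐ[volume.restrict (Ioo a b)] 0 := Lp.coeFn_zero _ _ _
      have h3 := diffOp_ae_eq A y l
      rw [h1] at h3
      simp only [firstOrderField_of_eq _ _ _ _ k.1 h' l, h']
      filter_upwards [h3, hDall, hz] with t e1 e2 e3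
      simp only [diffExpr, e2] at e1
      rw [PiLp.zero_apply, Sob.D_zero, e3, Pi.zero_apply] at e1
      rw [zero_add, neg_one_mul]
      exact eq_neg_of_add_eq_zero_left e1.symm
  have hXint : ∀ t ∈ Icc a b,
      X t = 0 + ∫ s in a..t, firstOrderField A (fun _ _ => 0) s (X s) := by
    intro t ht
    funext q
    rw [zero_add, integral_firstOrderField_apply hab A hf hXc ht q, ← primitive_congr (hN q) ht]
  have h0int : ∀ t ∈ Icc a b, (fun _ => 0 : ℝ → Fin r × Fin m → ℂ) t =
      0 + ∫ s in a..t, firstOrderField A (fun _ _ => 0) s 0 := by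
    intro t _
    have e : ∀ s, firstOrderField A (fun _ _ => 0) s 0 = 0 := by
      intro s
      funext q
      unfold firstOrderField
      split_ifs <;> simp
    simp only [e, intervalIntegral.integral_zero, add_zero]
  have hX0 := eqOn_of_integral_eq hab (intervalIntegrable_coeffBound hab A)
    (coeffBound_nonneg A) (norm_firstOrderField_sub_le A fun _ _ => 0)
    (fun X hX => intervalIntegrable_firstOrderField hab A hf hX.continuousOn) hXc
    continuousOn_const hXint h0int
  refine PiLp.ext fun l => Sob.ext_of_ae ?_
  have hz : ((0 : LpI a b p) : ℝ → ℂ) =ᵐ[volume.restrict (Ioo a b)] 0 := Lp.coeFn_zero _ _ _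
  filter_upwards [hD l ⟨0, by omega⟩, hz, ae_restrict_mem measurableSet_Ioo] with t e1 e2 ht
  rw [PiLp.zero_apply, Sob.D_zero, e2, Pi.zero_apply]
  refine Eq.trans e1 ?_
  rw [hX0 (Ioo_subset_Icc_self ht)]
  rfl

/-- A boundary-value problem with only the trivial homogeneous solution is uniquely solvable. -/
theorem existsUnique_isSolution (hab : a < b) (hr : 1 ≤ r) (A : Fin r → MSob a b p m n)
    (B : VSob a b p m (n + r) →L[ℂ] EuclideanSpace ℂ (Fin (r * m)))
    (h : ∀ y, IsSolution A B 0 0 y → y = 0) (f : VSob a b p m n)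
    (c : EuclideanSpace ℂ (Fin (r * m))) : ∃! y, IsSolution A B f c y := by
  let K := LinearMap.ker (diffOpLin A)
  -- Unique solvability of the Cauchy problem identifies the kernel with `ℂ^(r × m)`, so its
  -- dimension equals the number of boundary conditions.
  have hbij : Function.Bijective ((cauchyData hab).comp K.subtype :
      K →ₗ[ℂ] (Fin r × Fin m → ℂ)) := by
    constructor
    · rw [injective_iff_map_eq_zero]
      intro y hy
      exact Subtype.ext (eq_zero_of_diffOp_eq_zero hab hr A y y.2 hy)
    · intro x₀
      obtain ⟨y, hy, hy'⟩ := exists_diffOp_eq_and_cauchyData_eq hab hr A 0 x₀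
      exact ⟨⟨y, hy⟩, hy'⟩
  let e := LinearEquiv.ofBijective _ hbij
  have : FiniteDimensional ℂ K := e.symm.finiteDimensional
  have hdim : Module.finrank ℂ K = Module.finrank ℂ (EuclideanSpace ℂ (Fin (r * m))) := by
    rw [e.finrank_eq, Module.finrank_pi, finrank_euclideanSpace]
    simp
  have hL : Function.Surjective (diffOpLin A) := fun f =>
    (exists_diffOp_eq_and_cauchyData_eq hab hr A f 0).imp fun _ hy => hy.1
  exact existsUnique_of_ker_trivial (diffOpLin A) B.toLinearMap hL hdim
    (fun y h1 h2 => h y ⟨h1, h2⟩) f c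

end Cauchy

/-! ### Uniform two-sided bounds under strong convergence of finite-rank boundary operators. -/

section Abstract

variable {ι F G Z : Type*} [NormedAddCommGroup F] [NormedSpace ℂ F] [CompleteSpace F]
  [NormedAddCommGroup G] [NormedSpace ℂ G] [NormedAddCommGroup Z] [NormedSpace ℂ Z]

/-- The Banach–Steinhaus theorem along a countably generated filter. -/
theorem exists_eventually_norm_le_of_tendsto {l : Filter ι} [l.IsCountablyGenerated]
    {B : ι → F →L[ℂ] Z} {B₀ : F → Z} (h : ∀ y, Tendsto (fun i => B i y) l (𝓝 (B₀ y))) :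
    ∃ M : ℝ, ∀ᶠ i in l, ‖B i‖ ≤ M := by
  by_contra! hcon
  obtain ⟨s, hs⟩ := l.exists_antitone_basis
  -- Pointwise convergence along a filter gives no pointwise bound for all indices. A sequence
  -- converging along the filter with norms exceeding every `k` does have pointwise bounded orbits,
  -- which contradicts Banach–Steinhaus.
  have hex : ∀ k : ℕ, ∃ i ∈ s k, (k : ℝ) < ‖B i‖ := by
    intro k
    obtain ⟨i, hi, hi'⟩ := (hcon k).and_eventually (hs.1.mem_of_mem (i := k) trivial) |>.exists
    exact ⟨i, hi', hi⟩
  choose u hu hu' using hex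
  have hlim : Tendsto u atTop l := hs.tendsto hu
  obtain ⟨C, hC⟩ := banach_steinhaus (g := fun k => B (u k)) fun y => by
    obtain ⟨C, hC⟩ := ((h y).comp hlim).norm.bddAbove_range
    exact ⟨C, fun k => hC (mem_range_self k)⟩
  obtain ⟨k, hk⟩ := exists_nat_gt C
  exact absurd (hC k) (not_le.mpr (hk.trans (hu' k)))

/-- The operator norm is controlled by the values on a finite basis, so strong convergence on a
finite-dimensional space is norm convergence. -/
theorem eventually_norm_le_of_tendsto_zero [FiniteDimensional ℂ Z] {l : Filter ι}
    {T : ι → Z →L[ℂ] G} (h : ∀ c, Tendsto (fun i => T i c) l (𝓝 0)) {η : ℝ} (hη : 0 < η) :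
    ∀ᶠ i in l, ‖T i‖ ≤ η := by
  let v := Module.finBasis ℂ Z
  obtain ⟨C, hC0, hC⟩ := v.exists_opNorm_le (F := G)
  have hev : ∀ᶠ i in l, ∀ j, ‖T i (v j)‖ ≤ η / C := by
    rw [eventually_all]
    intro j
    have h1 := (h (v j)).norm
    rw [norm_zero] at h1
    exact h1.eventually_le_const (by positivity)
  filter_upwards [hev] with i hi
  refine (hC (by positivity) hi).trans (le_of_eq ?_)
  field_simp

/-- If `(L₀, B₀)` is invertible, `L i → L₀` uniformly on bounded sets and `B i → B₀` strongly
with finite-dimensional range, then `(L i, B i)` is eventually bounded above and below, uniformly in `i`. -/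
theorem eventually_norm_equiv [CompleteSpace G] [FiniteDimensional ℂ Z] {l : Filter ι}
    [l.IsCountablyGenerated] {L : ι → F → G} {L₀ : F →L[ℂ] G} {B : ι → F →L[ℂ] Z}
    {B₀ : F →L[ℂ] Z} {κ : ι → ℝ} (hκ : Tendsto κ l (𝓝 0))
    (hL : ∀ i y, ‖L i y - L₀ y‖ ≤ κ i * ‖y‖) (hB : ∀ y, Tendsto (fun i => B i y) l (𝓝 (B₀ y)))
    (h0 : ∀ g c, ∃! y, L₀ y = g ∧ B₀ y = c) :
    ∃ C M : ℝ, 0 < C ∧ 0 < M ∧ ∀ᶠ i in l, ∀ y,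
      ‖y‖ ≤ C * (‖L i y‖ + ‖B i y‖) ∧ ‖L i y‖ + ‖B i y‖ ≤ M * ‖y‖ := by
  have := FiniteDimensional.complete ℂ Z
  have hinj : (L₀.prod B₀).ker = ⊥ := by
    rw [LinearMap.ker_eq_bot']
    intro y hy
    obtain ⟨h1, h2⟩ := Prod.mk.inj hy
    exact (h0 0 0).unique ⟨h1, h2⟩ ⟨map_zero _, map_zero _⟩
  have hsurj : (L₀.prod B₀).range = ⊤ := by
    rw [LinearMap.range_eq_top]
    rintro ⟨g, c⟩
    obtain ⟨y, ⟨h1, h2⟩, -⟩ := h0 g c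
    exact ⟨y, Prod.ext h1 h2⟩
  let S : G × Z →L[ℂ] F := (ContinuousLinearEquiv.ofBijective (L₀.prod B₀) hinj hsurj).symm
  have hS : ∀ y, S (L₀ y, B₀ y) = y := fun y =>
    (ContinuousLinearEquiv.ofBijective (L₀.prod B₀) hinj hsurj).symm_apply_apply y
  obtain ⟨M, hM⟩ := exists_eventually_norm_le_of_tendsto hB
  -- `S ∘ inr` parametrises `ker L₀` by boundary values. On this finite-dimensional space `B i - B₀`
  -- becomes small in norm.
  have hN : ∀ᶠ i in l, ‖(B i - B₀).comp (S.comp (ContinuousLinearMap.inr ℂ G Z))‖ ≤ 1 / 2 := by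
    refine eventually_norm_le_of_tendsto_zero (fun c => ?_) (by norm_num)
    have := (hB (S (0, c))).sub_const (B₀ (S (0, c)))
    rw [sub_self] at this
    exact this
  set ρ := ‖S‖ with hρ
  have hρ0 : 0 ≤ ρ := norm_nonneg _
  set M' := |M| + ‖B₀‖ with hM'
  have hM'0 : 0 ≤ M' := by positivity
  set K := ρ * (1 + 2 * M' * ρ) with hK
  have hK0 : 0 ≤ K := by positivity
  have hLev : ∀ᶠ i in l, κ i ≤ 1 / (2 * (K + 1)) :=
    hκ.eventually_le_const (by positivity)
  -- Below, `‖y‖ ≤ K * ‖L₀ y‖ + 2 * ρ * ‖B i y‖`. Replacing `L₀` by `L i` costs at most `‖y‖ / 2` by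
  -- the choice of the bound on `κ i`; absorbing it doubles both constants. The `1` secures
  -- positivity.
  refine ⟨2 * K + 4 * ρ + 1, ‖L₀‖ + 1 / (2 * (K + 1)) + M' + 1, by positivity, by positivity, ?_⟩
  filter_upwards [hM, hN, hLev] with i h1 h2 h3 y
  have hBd : ‖B i - B₀‖ ≤ M' := (norm_sub_le _ _).trans (by
    have := le_abs_self M
    linarith)
  have hLy : ‖L i y - L₀ y‖ ≤ 1 / (2 * (K + 1)) * ‖y‖ :=
    (hL i y).trans (by gcongr)
  have e1 : ‖L₀ y‖ ≤ ‖L i y‖ + 1 / (2 * (K + 1)) * ‖y‖ :=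
    (norm_le_norm_add_norm_sub (L i y) (L₀ y)).trans (by gcongr)
  -- On the first summand the error of `B i` is merely bounded, but by a multiple of `‖L₀ y‖`. On
  -- the second, in `ker L₀`, it is at most `‖B₀ y‖ / 2` and can be absorbed.
  have hsplit : y = S (L₀ y, 0) + S (0, B₀ y) := by
    rw [← map_add, Prod.mk_add_mk, add_zero, zero_add, hS]
  have e2 : ‖(B i - B₀) (S (L₀ y, 0))‖ ≤ M' * (ρ * ‖L₀ y‖) := by
    refine (ContinuousLinearMap.le_opNorm _ _).trans ?_
    have : ‖S (L₀ y, 0)‖ ≤ ρ * ‖L₀ y‖ := by simpa using S.le_opNorm (L₀ y, 0)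
    gcongr
  have e3 : ‖(B i - B₀) (S (0, B₀ y))‖ ≤ 1 / 2 * ‖B₀ y‖ :=
    (ContinuousLinearMap.le_opNorm
      ((B i - B₀).comp (S.comp (ContinuousLinearMap.inr ℂ G Z))) (B₀ y)).trans (by gcongr)
  have e4 : ‖B₀ y‖ ≤ ‖B i y‖ + (M' * (ρ * ‖L₀ y‖) + 1 / 2 * ‖B₀ y‖) := by
    have h4 : ‖(B i - B₀) y‖ ≤ M' * (ρ * ‖L₀ y‖) + 1 / 2 * ‖B₀ y‖ := by
      have h5 := congrArg (B i - B₀) hsplit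
      rw [map_add] at h5
      rw [h5]
      exact (norm_add_le _ _).trans (add_le_add e2 e3)
    have : B₀ y = B i y - (B i - B₀) y := by simp
    calc ‖B₀ y‖ = ‖B i y - (B i - B₀) y‖ := by rw [← this]
      _ ≤ _ := (norm_sub_le _ _).trans (by gcongr)
  have e5 : ‖y‖ ≤ ρ * (‖L₀ y‖ + ‖B₀ y‖) := by
    have h4 := S.le_opNorm (L₀ y, B₀ y)
    rw [hS] at h4
    refine h4.trans ?_
    gcongr
    exact max_le_add_of_nonneg (norm_nonneg _) (norm_nonneg _)
  constructor
  · have e6 : ‖y‖ ≤ K * ‖L₀ y‖ + 2 * ρ * ‖B i y‖ := by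
      have : ρ * ‖B₀ y‖ ≤ ρ * (2 * ‖B i y‖ + 2 * (M' * (ρ * ‖L₀ y‖))) := by
        gcongr
        linarith
      rw [hK]
      linarith
    have e7 : K * ‖L₀ y‖ ≤ K * ‖L i y‖ + 1 / 2 * ‖y‖ := by
      have h4 : K * (1 / (2 * (K + 1))) ≤ 1 / 2 := by
        rw [mul_one_div, div_le_div_iff₀ (by positivity) (by positivity)]
        linarith
      calc K * ‖L₀ y‖ ≤ K * (‖L i y‖ + 1 / (2 * (K + 1)) * ‖y‖) := by gcongr
        _ = K * ‖L i y‖ + K * (1 / (2 * (K + 1))) * ‖y‖ := by ring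
        _ ≤ _ := by gcongr
    have n1 := norm_nonneg (L i y)
    have n2 := norm_nonneg (B i y)
    have m1 := mul_nonneg hρ0 n1
    have m2 := mul_nonneg hK0 n2
    linarith
  · have h4 := L₀.le_opNorm y
    have h5 : ‖L i y‖ ≤ ‖L₀ y‖ + ‖L i y - L₀ y‖ := norm_le_norm_add_norm_sub' _ _
    have h6 : ‖B i y‖ ≤ M' * ‖y‖ := by
      refine ((B i).le_opNorm y).trans ?_
      gcongr
      exact h1.trans ((le_abs_self M).trans (by simp [hM']))
    have := norm_nonneg y
    linarith

end Abstract

/-! ### The abstract bounds applied to the boundary-value problem. -/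

section Limit

variable {a b : ℝ} {p : ℝ≥0∞} [Fact (1 ≤ p)] {m n r : ℕ}

theorem existsUnique_diffOpCLM (hab : a < b) (hr : 1 ≤ r) {A : ℝ → Fin r → MSob a b p m n}
    {B : ℝ → VSob a b p m (n + r) →L[ℂ] EuclideanSpace ℂ (Fin (r * m))} (h0 : Condition0 A B)
    (f : VSob a b p m n) (c : EuclideanSpace ℂ (Fin (r * m))) :
    ∃! y, diffOpCLM hab (A 0) y = f ∧ B 0 y = c :=
  existsUnique_isSolution hab hr (A 0) (B 0) h0 f c

theorem eventually_norm_equiv_diffOp (hab : a < b) (hr : 1 ≤ r)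
    {A : ℝ → Fin r → MSob a b p m n}
    {B : ℝ → VSob a b p m (n + r) →L[ℂ] EuclideanSpace ℂ (Fin (r * m))}
    (h0 : Condition0 A B) (hI : LimitConditionI A) (hII : LimitConditionII B) :
    ∃ C M : ℝ, 0 < C ∧ 0 < M ∧ ∀ᶠ ε in 𝓝[>] (0 : ℝ), ∀ y : VSob a b p m (n + r),
      ‖y‖ ≤ C * (‖diffOp (A ε) y‖ + ‖B ε y‖) ∧ ‖diffOp (A ε) y‖ + ‖B ε y‖ ≤ M * ‖y‖ := by
  obtain ⟨C, hC0, hC⟩ := exists_norm_diffOp_sub_le hab p m n r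
  have h1 : Tendsto (fun ε => C * ∑ k, mnorm (A ε k - A 0 k)) (𝓝[>] 0) (𝓝 0) := by
    have := (tendsto_finsetSum Finset.univ fun k _ => hI k).const_mul C
    simpa using this
  have H := @eventually_norm_equiv ℝ (VSob a b p m (n + r)) (VSob a b p m n)
    (EuclideanSpace ℂ (Fin (r * m))) _ _ _ _ _ _ _ _ _ (𝓝[>] 0) _ fun ε => diffOp (A ε)
  exact @H (diffOpCLM hab (A 0)) B (B 0) _ h1 (fun ε y => hC (A ε) (A 0) y) hII
    (existsUnique_diffOpCLM hab hr h0)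

theorem diffOp_sub (A : Fin r → MSob a b p m n) (y z : VSob a b p m (n + r)) :
    diffOp A (y - z) = diffOp A y - diffOp A z :=
  LinearMap.map_sub (diffOpLin A) y z

end Limit

end GenericBVP

theorem theorem2 (a b : ℝ) (hab : a < b) (p : ℝ≥0∞) [Fact (1 ≤ p)] (m n r : ℕ)
    (hm : 1 ≤ m) (hr : 1 ≤ r) (ε₀ : ℝ) (hε₀ : 0 < ε₀)
    (A : ℝ → Fin r → MSob a b p m n)
    (B : ℝ → VSob a b p m (n + r) →L[ℂ] EuclideanSpace ℂ (Fin (r * m)))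
    (h0 : Condition0 A B) (hI : LimitConditionI A) (hII : LimitConditionII B) :
    ∃ ε₁ : ℝ, 0 < ε₁ ∧ ε₁ < ε₀ ∧
      (∀ ε, 0 ≤ ε → ε < ε₁ → ∀ (f : VSob a b p m n) (c : EuclideanSpace ℂ (Fin (r * m))),
        ∃! y : VSob a b p m (n + r), IsSolution (A ε) (B ε) f c y) ∧
      ∃ ε₂ γ₁ γ₂ : ℝ, 0 < ε₂ ∧ ε₂ < ε₁ ∧ 0 < γ₁ ∧ 0 < γ₂ ∧
        ∀ (f : ℝ → VSob a b p m n) (c : ℝ → EuclideanSpace ℂ (Fin (r * m)))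
          (y : ℝ → VSob a b p m (n + r)),
          (∀ ε, 0 ≤ ε → ε < ε₁ → IsSolution (A ε) (B ε) (f ε) (c ε) (y ε)) →
          ∀ ε, 0 < ε → ε < ε₂ →
            γ₁ * discrepancy (A ε) (B ε) (f ε) (c ε) (y 0) ≤ ‖y 0 - y ε‖ ∧
            ‖y 0 - y ε‖ ≤ γ₂ * discrepancy (A ε) (B ε) (f ε) (c ε) (y 0) := by
  have hsol0 := existsUnique_isSolution hab hr (A 0) (B 0) h0
  obtain ⟨C, M, hC, hM, hev⟩ := eventually_norm_equiv_diffOp hab hr h0 hI hII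
  obtain ⟨δ, hδ, hsub⟩ := mem_nhdsGT_iff_exists_Ioo_subset.mp hev
  have hδ' : (0 : ℝ) < δ := hδ
  have key : ∀ ε, 0 < ε → ε < δ → ∀ y : VSob a b p m (n + r),
      ‖y‖ ≤ C * (‖diffOp (A ε) y‖ + ‖B ε y‖) ∧
        ‖diffOp (A ε) y‖ + ‖B ε y‖ ≤ M * ‖y‖ := fun ε h1 h2 => hsub ⟨h1, h2⟩
  have hmin : 0 < min δ ε₀ := lt_min hδ' hε₀
  -- Halving and quartering provide the strict inequalities `ε₂ < ε₁ < ε₀`. The upper bound `M` of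
  -- the operator gives `γ₁ = M⁻¹`, its lower bound gives `γ₂ = C`.
  refine ⟨min δ ε₀ / 2, by linarith, by linarith [min_le_right δ ε₀], ?_,
    min δ ε₀ / 4, M⁻¹, C, by linarith, by linarith, by positivity, hC, ?_⟩
  · intro ε h1 h2
    rcases h1.eq_or_lt with rfl | h1
    · exact hsol0
    -- The lower bound forces a solution of the homogeneous problem at `ε` to vanish, so the
    -- Fredholm alternative applies there too.
    · refine existsUnique_isSolution hab hr (A ε) (B ε) fun y hy => ?_
      have h3 := (key ε h1 (by linarith [min_le_left δ ε₀]) y).1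
      rw [hy.1, hy.2, norm_zero, norm_zero, add_zero, mul_zero] at h3
      exact norm_le_zero_iff.mp h3
  · intro f c y hy ε h1 h2
    have hs := hy ε h1.le (by linarith)
    -- By linearity the image of `y 0 - y ε` under `(L(ε), B(ε))` is the pair of residuals of `y 0`,
    -- whose norms add up to the discrepancy.
    have h3 := key ε h1 (by linarith [min_le_left δ ε₀]) (y 0 - y ε)
    rw [diffOp_sub, hs.1, (B ε).map_sub, hs.2] at h3
    refine ⟨?_, h3.1⟩
    rw [inv_mul_le_iff₀ hM]
    exact h3.2
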